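/- Let $R$ be a commutative ring containing $\mathbb{Q}$, let $n$ be an odd positive integer, $[n]=\{1,\dots,n\}$, and let $R[\chi]=R[\chi_1,\dots,\chi_n]$ be the Grassmann algebra ($\chi_i\chi_j+\chi_j\chi_i=0$). Let $\partial/\partial\chi_i$ be the odd left derivations, and write $\int d\chi_n\cdots d\chi_1\, f=\frac{\partial}{\partial\chi_n}\cdots\frac{\partial}{\partial\chi_1}f$, which is the coefficient of $\chi_1\chi_2\cdots\chi_n$ in $f$. For each odd $k$ with $3\le k\le n$ let $y^{[k]}=(y^{[k]}_{\alpha_1\dots\alpha_k})_{\alpha\in[n]^k}$ be a completely antisymmetric tensor with entries in $R$, and put $$S_k=\frac1{(k-1)!}\sum_{(\alpha_1,\dots,\alpha_k)\in[n]^k} y^{[k]}_{\alpha_1\dots\alpha_k}\,\chi_{\alpha_2}\chi_{\alpha_3}\cdots\chi_{\alpha_k},\qquad S=\sum_{3\le k\le n,\ k\ \mathrm{odd}}S_k .$$ An odd cactus is a set $\mathcal A$ of subsets of $[n]$, each of odd cardinality at least $3$, such that the bipartite graph $G(\mathcal A)$ on $\mathcal A\sqcup[n]$, with an edge between $A\in\mathcal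 A$ and $j\in[n]$ whenever $j\in A$, is a tree. A refined cactus is a set $\mathcal C$ of sequences of odd length at least $3$ of distinct elements of $[n]$, such that distinct sequences of $\mathcal C$ have distinct underlying sets and the set $\mathcal A(\mathcal C)$ of these underlying sets is an odd cactus. Given a refined cactus $\mathcal C$ and a root $i\in[n]$, for $\alpha=(\alpha_1,\dots,\alpha_k)\in\mathcal C$ let $\alpha_s$ be the first element of $[n]$ on the path in $G(\mathcal A(\mathcal C))$ from the underlying set of $\alpha$ to $i$, and let $\hat\alpha=(\alpha_{s+1},\dots,\alpha_k,\alpha_1,\dots,\alpha_{s-1})$. Let $\pi$ be the sequence consisting of $i$ followed by the concatenation of the $\hat\alpha$, $\alpha\in\mathcal C$, in some order, and put $\mathcal Y_{i,\mathcal C}=\varepsilon(\pi)\prod_{\alpha\in\mathcal C}y_\alpha$, where $y_\alpha=y^{[k]}_{\alpha_1\dots\alpha_k}$. Then: 1. $S$ and all the $S_k$ are nilpotent, so that their exponentials are finite sums. The sequence $\pi$ is always a permutation of $[n]$. Every odd cactus $\mathcal A$ is $\mathcal A(\mathcal C)$ for some refined cactus $\mathcal C$, and $\mathcal Y_{\mathcal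 A}:=\mathcal Y_{i,\mathcal C}$ depends neither on the root $i$, nor on the refined cactus $\mathcal C$ with $\mathcal A(\mathcal C)=\mathcal A$, nor on the chosen order of $\mathcal C$. 2. For every $i\in[n]$, $$\int d\chi_n\cdots d\chi_1\ \chi_i\,\exp(S)=\sum_{\mathcal A}\mathcal Y_{\mathcal A},$$ the sum being over all odd cacti; in particular the left-hand side is independent of $i$. 3. For every odd $k$ with $3\le k\le n$ and every $i\in[n]$, $$\int d\chi_n\cdots d\chi_1\ \chi_i\,\exp(S_k)=(-1)^{i-1}\,\mathrm{Pf}^{[k-1]}(A^{(i)})=\sum_{\mathcal A\ k\text{-regular}}\mathcal Y_{\mathcal A},$$ the sum being over the odd cacti all of whose elements have cardinality $k$. Here $A_{\alpha_2\dots\alpha_k}=\sum_{\alpha_1=1}^n y^{[k]}_{\alpha_1\dots\alpha_k}$, $A^{(i)}$ is $A$ with its indices restricted to $[n]\setminus\{i\}$ (renumbered increasingly by $1,\dots,n-1$), and for a tensor $B$ with $m$ indices in $[N]$ the hyperpfaffian $\mathrm{Pf}^{[m]}(B)$ is $\frac1{p!}\sum_\sigma\varepsilon(\sigma)\prod_{j=0}^{p-1}B_{\sigma(mj+1)\dots\sigma(mj+m)}$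 if $N=mp$, the sum being over the permutations $\sigma$ of $[N]$ that are increasing on each block $\{mj+1,\dots,mj+m\}$, and $0$ if $m\nmid N$. 4. If $n\ge 3$ and $\Lambda_{ab}=\sum_{c=1}^n y^{[3]}_{cab}$, then for every $i\in[n]$ the usual Pfaffian of the matrix $\Lambda^{(i)}$, obtained from $\Lambda$ by removing row and column $i$, satisfies $(-1)^{i-1}\,\mathrm{Pf}(\Lambda^{(i)})=\sum_{\mathcal A\ 3\text{-regular}}\mathcal Y_{\mathcal A}$ (the Pfaffian-tree theorem of Masbaum and Vaintrob). -/

import Mathlib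

namespace HyperpfaffianCactus

/-! ### The Grassmann algebra and the Berezin integral -/

section Grassmann

variable {R : Type*} [CommRing R] {n : ℕ}

/-- The generator `χ_i` of the Grassmann algebra `R[χ_1, …, χ_n]`. This algebra is the exterior
algebra of `R ^ n` (over a ring in which `2` is invertible, the relations
`χ_i χ_j + χ_j χ_i = 0` are the defining relations of the exterior algebra).
Indices run over `Fin n`, that is, they start from `0`. -/
def chi (R : Type*) [CommRing R] {n : ℕ} (i : Fin n) : ExteriorAlgebra R (Fin n → R) :=
  ExteriorAlgebra.ι R (Pi.single i 1)

/-- The odd derivation `∂/∂χ_i`, acting from the left: the contraction with the `i`-th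
coordinate form. It kills the monomials without `χ_i`, and
`∂/∂χ_i (χ_{i_1} ⋯ χ_{i_p}) = (-1)^(a - 1) χ_{i_1} ⋯ (χ_{i_a} omitted) ⋯ χ_{i_p}`
if `i = i_a`. -/
noncomputable def partialChi (i : Fin n) :
    ExteriorAlgebra R (Fin n → R) →ₗ[R] ExteriorAlgebra R (Fin n → R) :=
  CliffordAlgebra.contractLeft (LinearMap.proj i)

/-- The Berezin integral `∫ dχ_n ⋯ dχ_1 f`: apply `∂/∂χ_1` first, then `∂/∂χ_2`, …, finally
`∂/∂χ_n`, and read the resulting element of degree zero as an element of `R`. -/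
noncomputable def berezin (f : ExteriorAlgebra R (Fin n → R)) : R :=
  ExteriorAlgebra.algebraMapInv ((List.finRange n).foldl (fun g i => partialChi i g) f)

/-- Complete antisymmetry of the tensors `y^[k]`, for `k` odd with `3 ≤ k ≤ n`. The other
members of the family `y` are irrelevant. -/
def IsAntisymmetricFamily (y : (k : ℕ) → (Fin k → Fin n) → R) : Prop :=
  ∀ k, Odd k → 3 ≤ k → k ≤ n → ∀ (α : Fin k → Fin n) (σ : Equiv.Perm (Fin k)),
    y k (α ∘ σ) = (Equiv.Perm.sign σ : ℤ) • y k α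

/-- The element `1/(k-1)! ∑_{α_1, …, α_k} y^[k]_{α_1 … α_k} χ_{α_2} χ_{α_3} ⋯ χ_{α_k}`. -/
noncomputable def actionTerm [Algebra ℚ R] (y : (k : ℕ) → (Fin k → Fin n) → R) (k : ℕ) :
    ExteriorAlgebra R (Fin n → R) :=
  (((k - 1).factorial : ℕ) : ℚ)⁻¹ •
    ∑ α : Fin k → Fin n, y k α • ((List.ofFn α).tail.map (chi R)).prod

/-- The sum of the previous elements over all odd `k` with `3 ≤ k ≤ n`. -/
noncomputable def action [Algebra ℚ R] (y : (k : ℕ) → (Fin k → Fin n) → R) :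
    ExteriorAlgebra R (Fin n → R) :=
  ∑ k ∈ (Finset.Icc 3 n).filter Odd, actionTerm y k

/-- The entry `y_α = y^[k]_{α_1 … α_k}` at a sequence `α = (α_1, …, α_k)`. -/
def entry (y : (k : ℕ) → (Fin k → Fin n) → R) (α : List (Fin n)) : R :=
  y α.length α.get

end Grassmann

/-! ### Cacti -/

section Cacti

variable {n : ℕ}

/-- The bipartite graph `G(𝒜)` on the disjoint union of `𝒜` and `[n]`: a set `A ∈ 𝒜` and an
element `j ∈ [n]` are adjacent if and only if `j ∈ A`. -/
def incidenceGraph (𝒜 : Finset (Finset (Fin n))) :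
    SimpleGraph ({A : Finset (Fin n) // A ∈ 𝒜} ⊕ Fin n) where
  Adj
    | Sum.inl A, Sum.inr j => j ∈ A.1
    | Sum.inr j, Sum.inl A => j ∈ A.1
    | _, _ => False
  symm := by
    constructor
    rintro (a | a) (b | b) h <;> exact h
  loopless := by
    constructor
    rintro (a | a) h <;> exact h

/-- Odd cacti: sets of subsets of `[n]` of odd cardinality at least `3` whose graph is a tree
(connecting all the vertices of `[n]`). -/
def IsOddCactus (𝒜 : Finset (Finset (Fin n))) : Prop :=
  (∀ A ∈ 𝒜, Odd A.card ∧ 3 ≤ A.card) ∧ (incidenceGraph 𝒜).IsTree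

open Classical in
/-- The finite set of all odd cacti on `[n]`. -/
noncomputable def oddCacti (n : ℕ) : Finset (Finset (Finset (Fin n))) :=
  Finset.univ.filter IsOddCactus

/-- The finite set of all `k`-regular odd cacti on `[n]`: those all of whose elements have
cardinality `k`. -/
noncomputable def regularCacti (n k : ℕ) : Finset (Finset (Finset (Fin n))) :=
  (oddCacti n).filter (fun 𝒜 => ∀ A ∈ 𝒜, A.card = k)

/-- The set `𝒜(𝒞)` of the underlying sets of the sequences in `𝒞`. -/
def underlying (𝒞 : Finset (List (Fin n))) : Finset (Finset (Fin n)) :=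
  𝒞.image List.toFinset

/-- Refined cacti: finite sets of sequences of distinct elements of `[n]`, of odd length at
least `3`, distinct sequences having distinct underlying sets, and the underlying sets
forming an odd cactus. -/
def IsRefinedCactus (𝒞 : Finset (List (Fin n))) : Prop :=
  (∀ α ∈ 𝒞, α.Nodup ∧ Odd α.length ∧ 3 ≤ α.length) ∧
  (∀ α ∈ 𝒞, ∀ β ∈ 𝒞, α ≠ β → α.toFinset ≠ β.toFinset) ∧
  IsOddCactus (underlying 𝒞)

/-- `j` is the first vertex of `[n]` on a path from `A` to the root `i` in `G(𝒜)`. If `𝒜` is a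
cactus, there is exactly one path from `A` to `i`, hence exactly one such `j`. -/
def IsLocalRoot (𝒜 : Finset (Finset (Fin n))) (i : Fin n) (A : Finset (Fin n)) (j : Fin n) :
    Prop :=
  ∃ (hA : A ∈ 𝒜) (p : (incidenceGraph 𝒜).Walk (Sum.inl ⟨A, hA⟩) (Sum.inr i)),
    p.IsPath ∧ p.snd = Sum.inr j

open Classical in
/-- The local root of `A` with respect to the root `i` (the value `i` if there is none). -/
noncomputable def localRoot (𝒜 : Finset (Finset (Fin n))) (i : Fin n) (A : Finset (Fin n)) :
    Fin n :=
  if h : ∃ j, IsLocalRoot 𝒜 i A j then h.choose else i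

/-- The circulation `(α_{s+1}, …, α_k, α_1, …, α_{s-1})` of `α ∈ 𝒞` with respect to the root `i`,
where `α_s` is the local root of `α`. -/
noncomputable def circulation (𝒞 : Finset (List (Fin n))) (i : Fin n) (α : List (Fin n)) :
    List (Fin n) :=
  (α.rotate (α.idxOf (localRoot (underlying 𝒞) i α.toFinset))).tail

variable {R : Type*} [CommRing R]

/-- `v` is the amplitude `𝒴_{i,𝒞} = ε_{i,𝒞} ∏_{α ∈ 𝒞} y_α`: for every ordering `L` of `𝒞`, the
sequence `π` formed by `i` followed by the concatenation along `L` of the circulations of the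
elements of `𝒞` is a permutation `σ` of `[n]`, and `v = ε(σ) ∏_{α ∈ 𝒞} y_α`. -/
def IsAmplitude (y : (k : ℕ) → (Fin k → Fin n) → R) (i : Fin n) (𝒞 : Finset (List (Fin n)))
    (v : R) : Prop :=
  ∀ L : List (List (Fin n)), L.Nodup → L.toFinset = 𝒞 →
    ∃ σ : Equiv.Perm (Fin n), List.ofFn σ = i :: L.flatMap (circulation 𝒞 i) ∧
      v = (Equiv.Perm.sign σ : ℤ) • ∏ α ∈ 𝒞, entry y α

end Cacti

/-! ### Pfaffians and hyperpfaffians -/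

section Pfaffian

variable {R : Type*} [CommRing R] [Algebra ℚ R]

/-- The `r`-th index of the `j`-th of the `N / m` consecutive blocks of length `m` in
`{0, …, N - 1}`. -/
def blockIndex {m N : ℕ} (j : Fin (N / m)) (r : Fin m) : Fin N :=
  ⟨m * j + r, by
    have h1 : m * (j + 1) ≤ m * (N / m) := Nat.mul_le_mul_left m j.2
    have h2 : m * (N / m) ≤ N := Nat.mul_div_le N m
    have h3 := r.2
    rw [Nat.mul_add] at h1
    omega⟩

/-- The order `m` hyperpfaffian of a tensor `A` with `m` indices in `{0, …, N - 1}`. If `N = m p`,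
it is `1/p! ∑_σ ε(σ) ∏_{j < p} A_{σ(mj), σ(mj+1), …, σ(mj+m-1)}`, over the permutations `σ` that
are increasing on each of the `p` blocks; it is zero if `m` does not divide `N`. -/
noncomputable def hyperpfaffian {m N : ℕ} (A : (Fin m → Fin N) → R) : R :=
  if m ∣ N then
    (((N / m).factorial : ℕ) : ℚ)⁻¹ •
      ∑ σ ∈ Finset.univ.filter (fun σ : Equiv.Perm (Fin N) =>
          ∀ (j : Fin (N / m)) (r s : Fin m), r < s → σ (blockIndex j r) < σ (blockIndex j s)),
        (Equiv.Perm.sign σ : ℤ) • ∏ j : Fin (N / m), A (fun r => σ (blockIndex j r))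
  else 0

/-- The usual Pfaffian of a skew-symmetric `N × N` matrix,
`1/(2^p p!) ∑_σ ε(σ) ∏_{j < p} M_{σ(2j), σ(2j+1)}` if `N = 2p`, and zero if `N` is odd. -/
noncomputable def pfaffian {N : ℕ} (M : Matrix (Fin N) (Fin N) R) : R :=
  if Even N then
    ((2 ^ (N / 2) * (N / 2).factorial : ℕ) : ℚ)⁻¹ •
      ∑ σ : Equiv.Perm (Fin N),
        (Equiv.Perm.sign σ : ℤ) •
          ∏ j : Fin (N / 2), M (σ (blockIndex j (0 : Fin 2))) (σ (blockIndex j (1 : Fin 2)))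
  else 0

/-- The increasing map from `{0, …, n - 2}` to `{0, …, n - 1}` whose range omits `i`. -/
def skip {n : ℕ} (i : Fin n) (a : Fin (n - 1)) : Fin n :=
  ⟨if (a : ℕ) < i then a else a + 1, by
    have h1 := a.2
    split_ifs <;> omega⟩

/-- The tensor `A^(i)` with `k - 1` indices: `A_{α_2 … α_k} = ∑_{α_1} y^[k]_{α_1 α_2 … α_k}`, with
the index `i` forbidden. -/
def contractedTensor {n : ℕ} (y : (k : ℕ) → (Fin k → Fin n) → R) (k : ℕ) (i : Fin n) :
    (Fin (k - 1) → Fin (n - 1)) → R :=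
  fun β => ∑ a : Fin n, entry y (a :: List.ofFn (fun r => skip i (β r)))

/-- The matrix obtained from `(Λ_{ab})`, `Λ_{ab} = ∑_c y^[3]_{cab}`, by removing the row and the
column of index `i`. -/
def contractedMatrix {n : ℕ} (y : (k : ℕ) → (Fin k → Fin n) → R) (i : Fin n) :
    Matrix (Fin (n - 1)) (Fin (n - 1)) R :=
  Matrix.of fun a b => ∑ c : Fin n, y 3 ![c, skip i a, skip i b]

end Pfaffian

end HyperpfaffianCactus

open HyperpfaffianCactus

/-! Let ∂ be the sum of all the ∂/∂χ_i. By antisymmetry, S is the sum of x_A = y_A ∂(χ_A) over the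
sets A of odd cardinality at least 3 (`actionTerm_eq`, `action_eq`). If A is listed with a in front,
then ∂(χ_A) is the product of the χ_b - χ_a over the other b in A, in order. Thus x_A has even
degree, so it is central, and its square is zero because a factor repeats. Hence exp(S) = ∏ (1 +
x_A), and the integral of χ_i exp(S) is the sum over all families 𝒜 of such sets of the integral of
χ_i ∏_{A ∈ 𝒜} x_A, called `amplitude` (`berezin_chi_mul_exp`).

These amplitudes are controlled by one principle: the integral of a derivative vanishes, and an
element killed by an odd derivation d with d v = 1 for some vector v is itself a derivative under d.
If G(𝒜) is disconnected, the derivation that is 0 on the component of i and 1 elsewhere kills the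
integrand; if G(𝒜) is connected but not a tree, the degree differs from n
(`amplitude_eq_zero_of_not_isTree`). So only cacti contribute. Since ∂ kills every x_A, it kills
(χ_i - χ_j) ∏ x_A, so the root is irrelevant (`amplitude_eq_amplitude`). For a cactus, take as base
point a of each A its local root. Going outward from i, χ_a is already a factor of the preceding
product, so χ_b - χ_a may be replaced by χ_b. What remains is the monomial of the sequence π, whose
integral is ε(π) (`IsRefinedCactus.isAmplitude`).

The hyperpfaffian comes from a second expansion of the same integral: S_k is homogeneous of degree k
- 1, so a single power of it contributes, and its monomials are indexed by permutations of the
complement of i (`berezin_chi_mul_exp_of_degree`). -/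

namespace HyperpfaffianCactus

/-! ### Products of vectors and contractions in an exterior algebra -/

section ExteriorAlgebraLemmas

variable {R M : Type*} [CommRing R] [AddCommGroup M] [Module R M]

/-- The product of a list of vectors in the exterior algebra. -/
def vecProd (R : Type*) {M : Type*} [CommRing R] [AddCommGroup M] [Module R M] (l : List M) :
    ExteriorAlgebra R M :=
  (l.map (ExteriorAlgebra.ι R)).prod

@[simp] lemma vecProd_nil : vecProd R ([] : List M) = 1 := rfl

@[simp] lemma vecProd_cons (v : M) (l : List M) :
    vecProd R (v :: l) = ExteriorAlgebra.ι R v * vecProd R l := by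
  simp [vecProd]

lemma vecProd_append (l l' : List M) : vecProd R (l ++ l') = vecProd R l * vecProd R l' := by
  simp [vecProd]

lemma ι_mul_ι_swap (v w : M) : ExteriorAlgebra.ι R v * ExteriorAlgebra.ι R w =
    -(ExteriorAlgebra.ι R w * ExteriorAlgebra.ι R v) :=
  eq_neg_of_add_eq_zero_left (ExteriorAlgebra.ι_add_mul_swap v w)

lemma ι_mul_vecProd (v : M) (l : List M) : ExteriorAlgebra.ι R v * vecProd R l =
    (-1) ^ l.length * (vecProd R l * ExteriorAlgebra.ι R v) := by
  induction l with
  | nil => simp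
  | cons w l ih =>
    rw [vecProd_cons, ← mul_assoc, ι_mul_ι_swap, neg_mul, mul_assoc, ih, List.length_cons, pow_succ]
    rcases neg_one_pow_eq_or (ExteriorAlgebra R M) l.length with h | h <;> simp [h, mul_assoc]

/-- Moving one vector across the product costs one sign per factor, and it is enough to commute with
the generators. -/
lemma vecProd_mem_center {l : List M} (hl : Even l.length) :
    vecProd R l ∈ Subalgebra.center R (ExteriorAlgebra R M) := by
  rw [Subalgebra.mem_center_iff]
  intro x
  induction x using ExteriorAlgebra.induction with
  | algebraMap r => exact Algebra.commutes r _
  | ι v => rw [ι_mul_vecProd, hl.neg_one_pow, one_mul]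
  | mul a b ha hb => rw [mul_assoc, hb, ← mul_assoc, ha, mul_assoc]
  | add a b ha hb => rw [add_mul, mul_add, ha, hb]

lemma vecProd_mul_comm {l : List M} (hl : Even l.length) (x : ExteriorAlgebra R M) :
    x * vecProd R l = vecProd R l * x :=
  Subalgebra.mem_center_iff.1 (vecProd_mem_center hl) x

/-- A rotation exchanges two consecutive pieces; their lengths add up to an odd number, so one of
them is even and its product is central. -/
lemma vecProd_rotate {l : List M} (hl : Odd l.length) (s : ℕ) :
    vecProd R (l.rotate s) = vecProd R l := by
  rw [← List.rotate_mod, List.rotate_eq_drop_append_take (Nat.mod_lt _ hl.pos).le]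
  conv_rhs => rw [← List.take_append_drop (s % l.length) l]
  rw [vecProd_append, vecProd_append]
  have h : Odd ((l.take (s % l.length)).length + (l.drop (s % l.length)).length) := by
    rwa [← List.length_append, List.take_append_drop]
  rcases Nat.even_or_odd (l.take (s % l.length)).length with h1 | h1
  · exact vecProd_mul_comm h1 _
  · exact (vecProd_mul_comm ((Nat.odd_add.1 h).1 h1) _).symm

lemma exteriorPower_zero_eq : ⋀[R]^0 M = 1 := pow_zero _

lemma exteriorPower_succ_eq (p : ℕ) :
    ⋀[R]^(p + 1) M = LinearMap.range (ExteriorAlgebra.ι R) * ⋀[R]^p M := pow_succ' _ _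

lemma vecProd_mem_exteriorPower (l : List M) : vecProd R l ∈ ⋀[R]^l.length M := by
  induction l with
  | nil => exact exteriorPower_zero_eq (R := R) (M := M) ▸ Submodule.one_le.1 le_rfl
  | cons v l ih =>
    rw [vecProd_cons, List.length_cons, exteriorPower_succ_eq]
    exact Submodule.mul_mem_mul ⟨v, rfl⟩ ih

lemma ι_mul_vecProd_of_mem {v : M} {l : List M} (h : v ∈ l) :
    ExteriorAlgebra.ι R v * vecProd R l = 0 := by
  induction l with
  | nil => simp at h
  | cons w l ih =>
    rw [vecProd_cons, ← mul_assoc]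
    rcases List.mem_cons.1 h with rfl | h
    · simp
    · rw [ι_mul_ι_swap, neg_mul, mul_assoc, ih h, mul_zero, neg_zero]

lemma vecProd_eq_zero_of_not_nodup {l : List M} (h : ¬ l.Nodup) : vecProd R l = 0 := by
  induction l with
  | nil => simp at h
  | cons v l ih =>
    rw [vecProd_cons]
    by_cases hv : v ∈ l
    · exact ι_mul_vecProd_of_mem hv
    · rw [ih fun hl => h (List.nodup_cons.2 ⟨hv, hl⟩), mul_zero]

/-- A central element of the form `∏ (w - v)` may be replaced by `∏ w` next to any factor
annihilated by `v`. -/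
lemma mul_vecProd_sub {x : ExteriorAlgebra R M} {v : M} (hx : x * ExteriorAlgebra.ι R v = 0)
    (l : List M) : x * vecProd R (l.map (· - v)) = x * vecProd R l := by
  induction l generalizing x with
  | nil => rfl
  | cons w l ih =>
    rw [List.map_cons, vecProd_cons, vecProd_cons, ← mul_assoc, ← mul_assoc, map_sub, mul_sub, hx,
      sub_zero]
    -- The hypothesis persists for the next factor, since x w v = -(x v) w = 0.
    exact ih (by rw [mul_assoc, ι_mul_ι_swap, mul_neg, ← mul_assoc, hx, zero_mul, neg_zero])

local notation "δ" => CliffordAlgebra.contractLeft (Q := (0 : QuadraticForm R M))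

lemma contractLeft_vecProd_eq_zero {d : Module.Dual R M} {l : List M} (h : ∀ v ∈ l, d v = 0) :
    δ d (vecProd R l) = 0 := by
  induction l with
  | nil => exact CliffordAlgebra.contractLeft_one (0 : QuadraticForm R M) (d := d)
  | cons v l ih =>
    rw [vecProd_cons]
    refine (CliffordAlgebra.contractLeft_ι_mul d v _).trans ?_
    rw [ih fun w hw => h w (List.mem_cons_of_mem _ hw), h v List.mem_cons_self]
    simp

lemma contractLeft_mul_eq_zero {d : Module.Dual R M} {l : List M} (h : ∀ v ∈ l, d v = 0)
    {y : ExteriorAlgebra R M} (hy : δ d y = 0) : δ d (vecProd R l * y) = 0 := by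
  induction l with
  | nil => simpa using hy
  | cons v l ih =>
    rw [vecProd_cons, mul_assoc]
    refine (CliffordAlgebra.contractLeft_ι_mul d v _).trans ?_
    rw [ih fun w hw => h w (List.mem_cons_of_mem _ hw), h v List.mem_cons_self]
    simp

/-- If `d v = 1`, the kernel of the contraction with `d` is contained in its range. -/
lemma eq_contractLeft_of_contractLeft_eq_zero {d : Module.Dual R M} {v : M} (hv : d v = 1)
    {x : ExteriorAlgebra R M} (hx : δ d x = 0) : x = δ d (ExteriorAlgebra.ι R v * x) := by
  refine Eq.symm ((CliffordAlgebra.contractLeft_ι_mul d v _).trans ?_)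
  rw [hv, hx, one_smul, mul_zero, sub_zero]

/-- Next to the factor `v`, each `w` may be changed to `w - v`. As `d (w - v) = 0`, the contraction
then only removes `v`. -/
lemma contractLeft_vecProd_cons {d : Module.Dual R M} {v : M} {l : List M} (hv : d v = 1)
    (h : ∀ w ∈ l, d w = 1) : δ d (vecProd R (v :: l)) = vecProd R (l.map (· - v)) := by
  rw [vecProd_cons, ← mul_vecProd_sub (ExteriorAlgebra.ι_sq_zero v), ← eq_contractLeft_of_contractLeft_eq_zero hv]
  refine contractLeft_vecProd_eq_zero fun w hw => ?_
  obtain ⟨u, hu, rfl⟩ := List.mem_map.1 hw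
  rw [map_sub, h u hu, hv, sub_self]

lemma contractLeft_mem_exteriorPower (d : Module.Dual R M) (p : ℕ) {x : ExteriorAlgebra R M}
    (hx : x ∈ ⋀[R]^(p + 1) M) : δ d x ∈ ⋀[R]^p M := by
  induction p generalizing x with
  | zero =>
    obtain ⟨v, rfl⟩ : x ∈ LinearMap.range (ExteriorAlgebra.ι R) := by
      rwa [exteriorPower_succ_eq, exteriorPower_zero_eq, mul_one] at hx
    rw [exteriorPower_zero_eq]
    exact Submodule.mem_one.2 ⟨d v, (CliffordAlgebra.contractLeft_ι (Q := (0 : QuadraticForm R M)) d v).symm⟩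
  | succ p ih =>
    rw [exteriorPower_succ_eq] at hx
    induction hx using Submodule.mul_induction_on' with
    | mem_mul_mem a ha b hb =>
      obtain ⟨v, rfl⟩ := ha
      have := CliffordAlgebra.contractLeft_ι_mul (Q := (0 : QuadraticForm R M)) d v b
      refine this ▸ Submodule.sub_mem _ (Submodule.smul_mem _ _ hb) ?_
      rw [exteriorPower_succ_eq]
      exact Submodule.mul_mem_mul ⟨v, rfl⟩ (ih hb)
    | add a _ b _ ha hb => rw [map_add]; exact Submodule.add_mem _ ha hb

lemma contractLeft_of_mem_exteriorPower_zero (d : Module.Dual R M) {x : ExteriorAlgebra R M}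
    (hx : x ∈ ⋀[R]^0 M) : δ d x = 0 := by
  rw [exteriorPower_zero_eq] at hx
  obtain ⟨r, rfl⟩ := Submodule.mem_one.1 hx
  exact CliffordAlgebra.contractLeft_algebraMap _ d r

lemma algebraMapInv_of_mem_exteriorPower {p : ℕ} {x : ExteriorAlgebra R M}
    (hx : x ∈ ⋀[R]^(p + 1) M) : ExteriorAlgebra.algebraMapInv x = 0 := by
  rw [exteriorPower_succ_eq] at hx
  induction hx using Submodule.mul_induction_on' with
  | mem_mul_mem a ha b hb =>
    obtain ⟨v, rfl⟩ := ha
    simp [ExteriorAlgebra.algebraMapInv]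
  | add a _ b _ ha hb => rw [map_add, ha, hb, add_zero]

end ExteriorAlgebraLemmas

/-! ### The Berezin integral: degree, derivatives and monomials -/

section Berezin

variable {R : Type*} [CommRing R] {n : ℕ}

/-- The product `χ_{a_1} ⋯ χ_{a_p}`. -/
def chiProd (R : Type*) [CommRing R] {n : ℕ} (l : List (Fin n)) : ExteriorAlgebra R (Fin n → R) :=
  (l.map (chi R)).prod

lemma chiProd_eq_vecProd (l : List (Fin n)) :
    chiProd R l = vecProd R (l.map fun i => (Pi.single i 1 : Fin n → R)) := by
  simp only [chiProd, vecProd, List.map_map]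
  rfl

@[simp] lemma chiProd_nil : chiProd R ([] : List (Fin n)) = 1 := rfl

@[simp] lemma chiProd_cons (i : Fin n) (l : List (Fin n)) :
    chiProd R (i :: l) = chi R i * chiProd R l := by
  simp [chiProd]

lemma chiProd_append (l l' : List (Fin n)) :
    chiProd R (l ++ l') = chiProd R l * chiProd R l' := by
  simp [chiProd]

lemma chiProd_eq_zero_of_not_nodup {l : List (Fin n)} (h : ¬ l.Nodup) : chiProd R l = 0 := by
  rw [chiProd_eq_vecProd]
  exact vecProd_eq_zero_of_not_nodup fun h' => h h'.of_map

/-- The result of applying successively the contractions with the coordinate forms of `l`. -/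
noncomputable def iterContract (l : List (Fin n)) (f : ExteriorAlgebra R (Fin n → R)) :
    ExteriorAlgebra R (Fin n → R) :=
  l.foldl (fun g i => partialChi i g) f

lemma berezin_eq (f : ExteriorAlgebra R (Fin n → R)) :
    berezin f = ExteriorAlgebra.algebraMapInv (iterContract (List.finRange n) f) := rfl

lemma iterContract_cons (i : Fin n) (l : List (Fin n)) (f : ExteriorAlgebra R (Fin n → R)) :
    iterContract (i :: l) f = iterContract l (partialChi i f) := rfl

lemma iterContract_add (l : List (Fin n)) (f g : ExteriorAlgebra R (Fin n → R)) :
    iterContract l (f + g) = iterContract l f + iterContract l g := by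
  induction l generalizing f g with
  | nil => rfl
  | cons i l ih => rw [iterContract_cons, map_add, ih]; rfl

lemma iterContract_smul (l : List (Fin n)) (r : R) (f : ExteriorAlgebra R (Fin n → R)) :
    iterContract l (r • f) = r • iterContract l f := by
  induction l generalizing f with
  | nil => rfl
  | cons i l ih => rw [iterContract_cons, map_smul, ih]; rfl

/-- The Berezin integral as a linear form. -/
noncomputable def berezinLin (R : Type*) [CommRing R] (n : ℕ) :
    ExteriorAlgebra R (Fin n → R) →ₗ[R] R where
  toFun := berezin
  map_add' f g := by simp only [berezin_eq, iterContract_add, map_add]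
  map_smul' r f := by simp only [berezin_eq, iterContract_smul, map_smul, RingHom.id_apply]

@[simp] lemma berezinLin_apply (f : ExteriorAlgebra R (Fin n → R)) :
    berezinLin R n f = berezin f := rfl

lemma iterContract_mem (l : List (Fin n)) {p : ℕ} {f : ExteriorAlgebra R (Fin n → R)}
    (hf : f ∈ ⋀[R]^(l.length + p) (Fin n → R)) : iterContract l f ∈ ⋀[R]^p (Fin n → R) := by
  induction l generalizing f with
  | nil => simpa [iterContract] using hf
  | cons i l ih =>
    refine ih (contractLeft_mem_exteriorPower _ _ ?_)
    convert hf using 2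
    simp only [List.length_cons]; omega

lemma iterContract_zero (l : List (Fin n)) :
    iterContract l (0 : ExteriorAlgebra R (Fin n → R)) = 0 := by
  simpa using iterContract_smul l (0 : R) 0

lemma iterContract_eq_zero (l : List (Fin n)) {p : ℕ} (hp : p < l.length)
    {f : ExteriorAlgebra R (Fin n → R)} (hf : f ∈ ⋀[R]^p (Fin n → R)) : iterContract l f = 0 := by
  induction l generalizing f p with
  | nil => simp at hp
  | cons i l ih =>
    rw [iterContract_cons]
    cases p with
    | zero => rw [partialChi, contractLeft_of_mem_exteriorPower_zero _ hf, iterContract_zero]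
    | succ p => exact ih (by simpa using hp) (contractLeft_mem_exteriorPower _ _ hf)

lemma berezin_of_mem_exteriorPower {p : ℕ} (hp : p ≠ n) {f : ExteriorAlgebra R (Fin n → R)}
    (hf : f ∈ ⋀[R]^p (Fin n → R)) : berezin f = 0 := by
  rw [berezin_eq]
  rcases hp.lt_or_gt with h | h
  · rw [iterContract_eq_zero _ (by simpa using h) hf, map_zero]
  · obtain ⟨q, rfl⟩ := Nat.exists_eq_add_of_lt h
    refine algebraMapInv_of_mem_exteriorPower (p := q) (iterContract_mem _ ?_)
    simpa [add_assoc] using hf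

/-- Contractions anticommute, so an additional one can be postponed to the end. -/
lemma iterContract_contractLeft (d : Module.Dual R (Fin n → R)) (l : List (Fin n))
    (f : ExteriorAlgebra R (Fin n → R)) :
    iterContract l (CliffordAlgebra.contractLeft d f) =
      (-1 : R) ^ l.length • (CliffordAlgebra.contractLeft d (iterContract l f)) := by
  induction l generalizing f with
  | nil => simp [iterContract]
  | cons i l ih =>
    have h := CliffordAlgebra.contractLeft_comm (Q := (0 : QuadraticForm R (Fin n → R)))
      (LinearMap.proj i) d f
    rw [iterContract_cons, partialChi, h, ← neg_one_smul R, iterContract_smul, ih, smul_smul,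
      List.length_cons, pow_succ']
    rfl

lemma contractLeft_iterContract_of_mem {i : Fin n} {l : List (Fin n)} (hi : i ∈ l)
    (f : ExteriorAlgebra R (Fin n → R)) :
    CliffordAlgebra.contractLeft (LinearMap.proj i) (iterContract l f) = 0 := by
  induction l generalizing f with
  | nil => simp at hi
  | cons j l ih =>
    rw [iterContract_cons]
    rcases List.mem_cons.1 hi with rfl | hi
    · rw [partialChi, iterContract_contractLeft, map_smul,
        CliffordAlgebra.contractLeft_contractLeft, smul_zero]
    · exact ih hi _

/-- The integral of a derivative vanishes: once postponed, each coordinate contraction in `d`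
repeats one already performed, and contractions square to zero. -/
lemma berezin_contractLeft (d : Module.Dual R (Fin n → R)) (f : ExteriorAlgebra R (Fin n → R)) :
    berezin (CliffordAlgebra.contractLeft d f) = 0 := by
  have hd : d = ∑ i, d (Pi.single i 1) • LinearMap.proj i := by
    refine LinearMap.pi_ext' fun i => LinearMap.ext_ring ?_
    simp [Pi.single_apply]
  rw [berezin_eq, iterContract_contractLeft, hd]
  simp only [map_sum, map_smul, LinearMap.sum_apply, LinearMap.smul_apply,
    contractLeft_iterContract_of_mem (List.mem_finRange _)]
  simp

/-- An element killed by an odd derivation `d` that takes the value `1` on some vector has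
integral zero. -/
lemma berezin_eq_zero_of_contractLeft_eq_zero {d : Module.Dual R (Fin n → R)} {v : Fin n → R}
    (hv : d v = 1) {f : ExteriorAlgebra R (Fin n → R)}
    (hf : CliffordAlgebra.contractLeft d f = 0) : berezin f = 0 := by
  rw [eq_contractLeft_of_contractLeft_eq_zero hv hf]
  exact berezin_contractLeft d _

lemma iterContract_chiProd {l : List (Fin n)} (hl : l.Nodup) :
    iterContract l (chiProd R l) = 1 := by
  induction l with
  | nil => rfl
  | cons i l ih =>
    have h0 : partialChi i (chiProd R l) = 0 := by
      rw [chiProd_eq_vecProd]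
      refine contractLeft_vecProd_eq_zero fun v hv => ?_
      obtain ⟨j, hj, rfl⟩ := List.mem_map.1 hv
      have : i ≠ j := fun h => (List.nodup_cons.1 hl).1 (h ▸ hj)
      rw [LinearMap.proj_apply, Pi.single_eq_of_ne this]
    have h : partialChi i (chiProd R (i :: l)) = chiProd R l := by
      have h1 : (LinearMap.proj i : (Fin n → R) →ₗ[R] R) (Pi.single i 1) = 1 := by
        rw [LinearMap.proj_apply, Pi.single_eq_same]
      rw [chiProd_cons]
      exact (eq_contractLeft_of_contractLeft_eq_zero h1 h0).symm
    rw [iterContract_cons, h, ih (List.nodup_cons.1 hl).2]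

lemma chiProd_ofFn_comp_perm {m : ℕ} (α : Fin m → Fin n) (σ : Equiv.Perm (Fin m)) :
    chiProd R (List.ofFn (α ∘ σ)) = (Equiv.Perm.sign σ : ℤ) • chiProd R (List.ofFn α) := by
  have h : ∀ β : Fin m → Fin n, chiProd R (List.ofFn β) =
      ExteriorAlgebra.ιMulti R m (fun j => (Pi.single (β j) 1 : Fin n → R)) := by
    intro β
    rw [ExteriorAlgebra.ιMulti_apply, chiProd, List.map_ofFn]
    rfl
  rw [h, h]
  exact (ExteriorAlgebra.ιMulti R m).map_perm (fun j => (Pi.single (α j) 1 : Fin n → R)) σ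

lemma berezin_chiProd_perm (σ : Equiv.Perm (Fin n)) :
    berezin (chiProd R (List.ofFn σ)) = ((Equiv.Perm.sign σ : ℤ) : R) := by
  have h := chiProd_ofFn_comp_perm (R := R) (id : Fin n → Fin n) σ
  rw [Function.id_comp] at h
  rw [h, ← berezinLin_apply, map_zsmul, berezinLin_apply, List.ofFn_id, berezin_eq,
    iterContract_chiProd (List.nodup_finRange n), map_one, zsmul_one]

lemma chiProd_mem_exteriorPower (l : List (Fin n)) :
    chiProd R l ∈ ⋀[R]^l.length (Fin n → R) := by
  rw [chiProd_eq_vecProd]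
  simpa using vecProd_mem_exteriorPower (R := R) (l.map fun i => (Pi.single i 1 : Fin n → R))

lemma chi_mul_chiProd_of_mem {i : Fin n} {l : List (Fin n)} (h : i ∈ l) :
    chi R i * chiProd R l = 0 := by
  rw [← chiProd_cons]
  exact chiProd_eq_zero_of_not_nodup fun h' => (List.nodup_cons.1 h').1 h

end Berezin

end HyperpfaffianCactus

namespace HyperpfaffianCactus

/-! ### From sums over tuples to sums over sets -/

section Symmetrization

variable {R : Type*} [CommRing R] {n : ℕ}

lemma exists_perm_comp_eq {m : ℕ} {α β : Fin m → Fin n} (hα : Function.Injective α)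
    (hβ : Function.Injective β) (h : Set.range α = Set.range β) :
    ∃ σ : Equiv.Perm (Fin m), α = β ∘ σ := by
  refine ⟨(Equiv.ofInjective α hα).trans ((Equiv.setCongr h).trans (Equiv.ofInjective β hβ).symm),
    funext fun j => ?_⟩
  have := Equiv.apply_ofInjective_symm hβ (Equiv.setCongr h (Equiv.ofInjective α hα j))
  simpa using this.symm

/-- Every injective tuple is, in exactly one way, an increasing tuple composed with a permutation.
-/
lemma sum_eq_factorial_nsmul_sum_strictMono {m : ℕ} {G : Type*} [AddCommMonoid G]
    {g : (Fin m → Fin n) → G} (hg : ∀ α (σ : Equiv.Perm (Fin m)), g (α ∘ σ) = g α)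
    (h0 : ∀ α, ¬ Function.Injective α → g α = 0) :
    ∑ α, g α = m.factorial • ∑ α with StrictMono α, g α := by
  have h1 : ∑ α : Fin m → Fin n with Function.Injective α, g α = ∑ α, g α :=
    Finset.sum_filter_of_ne fun α _ h => by_contra fun h' => h (h0 α h')
  have h2 : ∑ p ∈ (Finset.univ.filter fun α : Fin m → Fin n => StrictMono α) ×ˢ
      (Finset.univ : Finset (Equiv.Perm (Fin m))), g p.1 =
      ∑ α : Fin m → Fin n with Function.Injective α, g α := by
    refine Finset.sum_bij (fun p _ => p.1 ∘ p.2) ?_ ?_ ?_ ?_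
    · rintro ⟨α, σ⟩ hp
      simp only [Finset.mem_product, Finset.mem_filter, Finset.mem_univ, true_and, and_true] at hp ⊢
      exact hp.injective.comp σ.injective
    · rintro ⟨α, σ⟩ hp ⟨β, τ⟩ hq h
      simp only [Finset.mem_product, Finset.mem_filter, Finset.mem_univ, true_and, and_true]
        at hp hq h
      have h3 : α = β := by
        rw [← hp.range_inj hq, ← σ.surjective.range_comp α, h, τ.surjective.range_comp β]
      subst h3
      exact Prod.ext rfl (Equiv.ext fun j => hp.injective (congrFun h j))
    · intro α hα
      simp only [Finset.mem_filter, Finset.mem_univ, true_and] at hα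
      refine ⟨(α ∘ Tuple.sort α, (Tuple.sort α)⁻¹), ?_, ?_⟩
      · simp only [Finset.mem_product, Finset.mem_filter, Finset.mem_univ, true_and, and_true]
        exact (Tuple.monotone_sort α).strictMono_of_injective
          (hα.comp (Tuple.sort α).injective)
      · funext j; simp
    · rintro ⟨α, σ⟩ _
      exact (hg α σ).symm
  rw [← h1, ← h2, Finset.sum_product]
  simp [Finset.sum_nsmul, Fintype.card_perm]

lemma sum_strictMono_eq_sum_finset {m : ℕ} {G : Type*} [AddCommMonoid G]
    {g : (Fin m → Fin n) → G} {h : Finset (Fin n) → G}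
    (hgh : ∀ α, Function.Injective α → g α = h (Finset.univ.image α)) :
    ∑ α with StrictMono α, g α = ∑ A with A.card = m, h A := by
  refine Finset.sum_bij (fun α _ => Finset.univ.image α) ?_ ?_ ?_ ?_
  · intro α hα
    simp only [Finset.mem_filter, Finset.mem_univ, true_and] at hα ⊢
    rw [Finset.card_image_of_injective _ hα.injective, Finset.card_univ, Fintype.card_fin]
  · intro α hα β hβ hαβ
    simp only [Finset.mem_filter, Finset.mem_univ, true_and] at hα hβ
    rw [← hα.range_inj hβ]
    simpa using congrArg (fun s : Finset (Fin n) => (s : Set (Fin n))) hαβ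
  · intro A hA
    simp only [Finset.mem_filter, Finset.mem_univ, true_and] at hA
    refine ⟨A.orderEmbOfFin hA, by simpa using (A.orderEmbOfFin hA).strictMono, ?_⟩
    exact Finset.image_orderEmbOfFin_univ A hA
  · intro α hα
    simp only [Finset.mem_filter, Finset.mem_univ, true_and] at hα
    exact hgh α hα.injective

end Symmetrization

/-! ### The exponent as a sum over sets -/

section Action

variable {R : Type*} [CommRing R] {n : ℕ}

/-- The linear form whose value at every coordinate vector is `1`. -/
def sumForm (R : Type*) [CommRing R] (n : ℕ) : Module.Dual R (Fin n → R) := ∑ i, LinearMap.proj i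

lemma sumForm_single (i : Fin n) : sumForm R n (Pi.single i 1) = 1 := by
  simp [sumForm, LinearMap.sum_apply, Pi.single_apply]

/-- The odd derivation `∂/∂χ_1 + ⋯ + ∂/∂χ_n`. -/
noncomputable def totalD : ExteriorAlgebra R (Fin n → R) →ₗ[R] ExteriorAlgebra R (Fin n → R) :=
  CliffordAlgebra.contractLeft (sumForm R n)

lemma totalD_chi_mul (i : Fin n) (x : ExteriorAlgebra R (Fin n → R)) :
    totalD (chi R i * x) = x - chi R i * totalD x := by
  refine (CliffordAlgebra.contractLeft_ι_mul (sumForm R n) _ _).trans ?_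
  rw [sumForm_single, one_smul]
  rfl

lemma totalD_chiProd_ofFn {m : ℕ} (α : Fin (m + 1) → Fin n) :
    totalD (chiProd R (List.ofFn α)) =
      ∑ j : Fin (m + 1), (-1 : R) ^ (j : ℕ) • chiProd R (List.ofFn (α ∘ j.succAbove)) := by
  induction m with
  | zero =>
    have : totalD (1 : ExteriorAlgebra R (Fin n → R)) = 0 :=
      CliffordAlgebra.contractLeft_one (0 : QuadraticForm R (Fin n → R)) (d := sumForm R n)
    have h := totalD_chi_mul (R := R) (α 0) 1
    rw [mul_one, this, mul_zero, sub_zero] at h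
    simp [h]
  | succ m ih =>
    rw [List.ofFn_succ, chiProd_cons, totalD_chi_mul, Fin.sum_univ_succ, sub_eq_add_neg]
    congr 1
    · simp [Function.comp_def]
    · rw [ih, Finset.mul_sum, ← Finset.sum_neg_distrib]
      refine Finset.sum_congr rfl fun j _ => ?_
      rw [List.ofFn_succ, chiProd_cons, mul_smul_comm, Fin.val_succ, pow_succ, mul_neg_one,
        neg_smul]
      simp [Function.comp_def]

lemma entry_ofFn {S : Type*} (y : (k : ℕ) → (Fin k → Fin n) → S) {k : ℕ} (α : Fin k → Fin n) :
    entry y (List.ofFn α) = y k α := by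
  -- The length of `List.ofFn α` equals `k` only propositionally, so it is replaced by a variable
  -- that can be substituted.
  have h : ∀ (k' : ℕ) (hk : k' = k) (β : Fin k' → Fin n), (∀ j, β j = α (Fin.cast hk j)) →
      y k' β = y k α := by
    rintro _ rfl β hβ
    exact congrArg _ (funext hβ)
  exact h _ (List.length_ofFn) _ fun j => by
    rw [List.get_ofFn]

/-- The contribution `y_A ∂(χ_A)` of a set `A` to the exponent, where `∂` is the sum of all the
`∂/∂χ_i`. -/
noncomputable def setTerm (y : (k : ℕ) → (Fin k → Fin n) → R) (A : Finset (Fin n)) :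
    ExteriorAlgebra R (Fin n → R) :=
  entry y A.sort • totalD (chiProd R A.sort)

lemma IsAntisymmetricFamily.smul_chiProd_comp_perm {y : (k : ℕ) → (Fin k → Fin n) → R}
    (hy : IsAntisymmetricFamily y) {k : ℕ} (hk : Odd k) (h3 : 3 ≤ k) (hn : k ≤ n)
    (α : Fin k → Fin n) (σ : Equiv.Perm (Fin k)) :
    y k (α ∘ σ) • chiProd R (List.ofFn (α ∘ σ)) = y k α • chiProd R (List.ofFn α) := by
  rw [hy k hk h3 hn, chiProd_ofFn_comp_perm]
  rcases Int.units_eq_one_or (Equiv.Perm.sign σ) with h | h <;> simp [h]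

/-- Transposing two equal indices gives y = -y, and 2 is invertible. -/
lemma IsAntisymmetricFamily.eq_zero_of_not_injective [Algebra ℚ R]
    {y : (k : ℕ) → (Fin k → Fin n) → R}
    (hy : IsAntisymmetricFamily y) {k : ℕ} (hk : Odd k) (h3 : 3 ≤ k) (hn : k ≤ n)
    {α : Fin k → Fin n} (hα : ¬ Function.Injective α) : y k α = 0 := by
  simp only [Function.Injective, not_forall] at hα
  obtain ⟨a, b, hab, hne⟩ := hα
  have h := hy k hk h3 hn α (Equiv.swap a b)
  have h' : α ∘ Equiv.swap a b = α := by
    funext j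
    simp only [Function.comp_apply, Equiv.swap_apply_def]
    split_ifs with h1 h2
    · rw [h1, hab]
    · rw [h2, hab]
    · rfl
  rw [h', Equiv.Perm.sign_swap hne] at h
  have h2 : (2 : ℚ) • y k α = 0 := by
    rw [two_smul]
    nth_rewrite 1 [h]
    simp
  simpa using h2

/-- The sign of a reordering enters both y_α and χ_α and cancels, so any listing of the set can
replace the sorted one. -/
lemma setTerm_eq {y : (k : ℕ) → (Fin k → Fin n) → R} (hy : IsAntisymmetricFamily y)
    {l : List (Fin n)} (hl : l.Nodup) (hk : Odd l.length) (h3 : 3 ≤ l.length) :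
    setTerm y l.toFinset = entry y l • totalD (chiProd R l) := by
  have key : ∀ (k : ℕ) (α β : Fin k → Fin n), Function.Injective α → Function.Injective β →
      Set.range α = Set.range β → Odd k → 3 ≤ k →
      entry y (List.ofFn α) • chiProd R (List.ofFn α) =
        entry y (List.ofFn β) • chiProd R (List.ofFn β) := by
    intro k α β hα hβ hr hk h3
    obtain ⟨σ, rfl⟩ := exists_perm_comp_eq hα hβ hr
    rw [entry_ofFn, entry_ofFn]
    exact hy.smul_chiProd_comp_perm hk h3 (by simpa using Fintype.card_le_of_injective _ hβ) _ _
  have hlen : l.toFinset.sort.length = l.length := by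
    rw [Finset.length_sort, List.toFinset_card_of_nodup hl]
  obtain ⟨α, hα⟩ : ∃ α : Fin l.length → Fin n, List.ofFn α = l := ⟨l.get, List.ofFn_get l⟩
  obtain ⟨β, hβ⟩ : ∃ β : Fin l.length → Fin n, List.ofFn β = l.toFinset.sort (· ≤ ·) := by
    rw [← hlen]; exact ⟨_, List.ofFn_get _⟩
  have h := key _ β α (by rw [← List.nodup_ofFn, hβ]; exact Finset.sort_nodup _ _)
    (by rw [← List.nodup_ofFn, hα]; exact hl) (by
      ext j
      change (∃ a, β a = j) ↔ ∃ a, α a = j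
      rw [← List.mem_ofFn, ← List.mem_ofFn, hα, hβ]; simp) hk h3
  rw [hα, hβ] at h
  rw [setTerm, ← map_smul, ← map_smul, h]

/-- The sum of y_α ∂(χ_α) over all k-tuples is computed twice. Each of the k terms of the derivative
contributes the unnormalized sum `T`, while grouping by underlying set gives k! times the sum of the
set terms. The quotient accounts for the factor 1/(k-1)!. -/
lemma actionTerm_eq [Algebra ℚ R] {y : (k : ℕ) → (Fin k → Fin n) → R}
    (hy : IsAntisymmetricFamily y) {k : ℕ} (hk : Odd k) (h3 : 3 ≤ k) (hn : k ≤ n) :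
    actionTerm y k = ∑ A with A.card = k, setTerm y A := by
  obtain ⟨m, rfl⟩ : ∃ m, k = m + 1 := ⟨k - 1, by omega⟩
  set T : ExteriorAlgebra R (Fin n → R) :=
    ∑ α : Fin (m + 1) → Fin n, y (m + 1) α • ((List.ofFn α).tail.map (chi R)).prod with hT
  have h1 : ∑ α : Fin (m + 1) → Fin n, y (m + 1) α • totalD (chiProd R (List.ofFn α)) =
      (m + 1) • T := by
    simp_rw [totalD_chiProd_ofFn, Finset.smul_sum]
    rw [Finset.sum_comm]
    rw [Finset.sum_congr rfl (g := fun _ => T), Finset.sum_const, Finset.card_univ,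
      Fintype.card_fin]
    intro j _
    rw [hT]
    -- The cycle brings position `j` to the front; its sign (-1)^j cancels the sign of the
    -- derivation.
    refine Fintype.sum_equiv (Equiv.arrowCongr j.cycleRange (Equiv.refl _)) _ _ fun α => ?_
    have h2 : α = (α ∘ j.cycleRange.symm) ∘ j.cycleRange := by
      funext a; simp
    change _ = y (m + 1) (α ∘ j.cycleRange.symm) •
      chiProd R (List.ofFn (α ∘ j.cycleRange.symm)).tail
    have h3' : y (m + 1) α = (-1 : R) ^ (j : ℕ) * y (m + 1) (α ∘ j.cycleRange.symm) := by
      conv_lhs => rw [h2]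
      rw [hy _ hk h3 hn, Fin.sign_cycleRange]
      simp
    have h4 : α ∘ j.succAbove = fun a => (α ∘ j.cycleRange.symm) (Fin.succ a) := by
      funext a; simp
    rw [h3', h4, List.ofFn_succ, List.tail_cons, smul_smul, mul_right_comm, ← mul_pow]
    simp
  rw [sum_eq_factorial_nsmul_sum_strictMono, sum_strictMono_eq_sum_finset (h := setTerm y)] at h1
  · have h2 : ((m + 1 : ℕ) : ℚ) • T =
        (((m + 1).factorial : ℕ) : ℚ) • ∑ A with A.card = m + 1, setTerm y A := by
      rw [Nat.cast_smul_eq_nsmul, Nat.cast_smul_eq_nsmul, h1]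
    change ((m.factorial : ℕ) : ℚ)⁻¹ • T = _
    rw [Nat.factorial_succ, Nat.cast_mul, mul_smul] at h2
    have h5 := congrArg (fun x => (((m + 1 : ℕ) : ℚ) * (m.factorial : ℚ))⁻¹ • x) h2
    simp only [smul_smul] at h5
    have h6 : (m.factorial : ℚ) ≠ 0 := by exact_mod_cast m.factorial_ne_zero
    have h7 : ((m + 1 : ℕ) : ℚ) ≠ 0 := by exact_mod_cast m.succ_ne_zero
    rw [show (((m + 1 : ℕ) : ℚ) * (m.factorial : ℚ))⁻¹ * ((m + 1 : ℕ) : ℚ) =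
      (m.factorial : ℚ)⁻¹ by field_simp, inv_mul_cancel₀ (mul_ne_zero h7 h6), one_smul] at h5
    exact h5
  · intro α hα
    have h2 := setTerm_eq hy (List.nodup_ofFn.2 hα) (by simpa using hk) (by simpa using h3)
    rw [entry_ofFn] at h2
    rw [← h2]
    congr 1
    ext a
    rw [List.mem_toFinset, List.mem_ofFn]
    simp
  · intro α σ
    rw [← map_smul, ← map_smul, hy.smul_chiProd_comp_perm hk h3 hn]
  · intro α hα
    rw [hy.eq_zero_of_not_injective hk h3 hn hα, zero_smul]

lemma action_eq [Algebra ℚ R] {y : (k : ℕ) → (Fin k → Fin n) → R}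
    (hy : IsAntisymmetricFamily y) :
    action y = ∑ A : Finset (Fin n) with Odd A.card ∧ 3 ≤ A.card, setTerm y A := by
  rw [action, ← Finset.sum_fiberwise_of_maps_to (g := Finset.card)
    (t := (Finset.Icc 3 n).filter Odd)]
  · refine Finset.sum_congr rfl fun k hk => ?_
    simp only [Finset.mem_filter, Finset.mem_Icc] at hk
    rw [actionTerm_eq hy hk.2 hk.1.1 hk.1.2]
    refine Finset.sum_congr ?_ fun _ _ => rfl
    ext A
    simp only [Finset.mem_filter, Finset.mem_univ, true_and]
    constructor
    · rintro rfl; exact ⟨⟨hk.2, hk.1.1⟩, rfl⟩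
    · exact fun h => h.2
  · intro A hA
    simp only [Finset.mem_filter, Finset.mem_univ, true_and, Finset.mem_Icc] at hA ⊢
    exact ⟨⟨hA.2, by simpa using A.card_le_univ⟩, hA.1⟩

end Action

end HyperpfaffianCactus

namespace HyperpfaffianCactus

/-! ### Paths to the root and edge counts in the incidence graph -/

section Tree

variable {n : ℕ} {𝒜 : Finset (Finset (Fin n))}

lemma not_adj_inl_inl (A B : {A : Finset (Fin n) // A ∈ 𝒜}) :
    ¬ (incidenceGraph 𝒜).Adj (Sum.inl A) (Sum.inl B) := fun h => h

lemma not_adj_inr_inr (a b : Fin n) :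
    ¬ (incidenceGraph 𝒜).Adj (Sum.inr a) (Sum.inr b) := fun h => h

lemma exists_isLocalRoot (h𝒜 : (incidenceGraph 𝒜).Connected) (i : Fin n) {A : Finset (Fin n)}
    (hA : A ∈ 𝒜) : ∃ j, IsLocalRoot 𝒜 i A j := by
  obtain ⟨p, hp, -⟩ := h𝒜.exists_path_of_dist (Sum.inl ⟨A, hA⟩) (Sum.inr i)
  have hnil : ¬ p.Nil := fun h => by simpa using h.eq
  have hadj := p.adj_snd hnil
  rcases h : p.snd with B | j
  · rw [h] at hadj
    exact (not_adj_inl_inl _ _ hadj).elim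
  · exact ⟨j, hA, p, hp, h⟩

lemma isLocalRoot_localRoot (h𝒜 : (incidenceGraph 𝒜).Connected) (i : Fin n) {A : Finset (Fin n)}
    (hA : A ∈ 𝒜) : IsLocalRoot 𝒜 i A (localRoot 𝒜 i A) := by
  have h := exists_isLocalRoot h𝒜 i hA
  rw [localRoot, dif_pos h]
  exact h.choose_spec

lemma localRoot_mem (h𝒜 : (incidenceGraph 𝒜).Connected) (i : Fin n) {A : Finset (Fin n)}
    (hA : A ∈ 𝒜) : localRoot 𝒜 i A ∈ A := by
  obtain ⟨_, p, _, hp⟩ := isLocalRoot_localRoot h𝒜 i hA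
  have hnil : ¬ p.Nil := fun h => by simpa using h.eq
  have hadj := p.adj_snd hnil
  rw [hp] at hadj
  exact hadj

lemma path_length_eq_dist {V : Type*} {G : SimpleGraph V} (hG : G.IsTree) {u v : V}
    {p : G.Walk u v} (hp : p.IsPath) : p.length = G.dist u v := by
  obtain ⟨q, hq, hd⟩ := hG.connected.exists_path_of_dist u v
  have := congrArg Subtype.val ((hG.isAcyclic.subsingleton_path u v).elim ⟨p, hp⟩ ⟨q, hq⟩)
  rw [← hd]
  exact congrArg SimpleGraph.Walk.length this

open Classical in
/-- The distance from an element of `𝒜` to the root. -/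
noncomputable def setDepth (𝒜 : Finset (Finset (Fin n))) (i : Fin n) (A : Finset (Fin n)) : ℕ :=
  if hA : A ∈ 𝒜 then (incidenceGraph 𝒜).dist (Sum.inl ⟨A, hA⟩) (Sum.inr i) else 0

lemma dist_localRoot_lt (h𝒜 : (incidenceGraph 𝒜).IsTree) (i : Fin n) {A : Finset (Fin n)}
    (hA : A ∈ 𝒜) :
    (incidenceGraph 𝒜).dist (Sum.inr (localRoot 𝒜 i A)) (Sum.inr i) < setDepth 𝒜 i A := by
  obtain ⟨_, p, hp, hs⟩ := isLocalRoot_localRoot h𝒜.connected i hA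
  have hnil : ¬ p.Nil := fun h => by simpa using h.eq
  rw [setDepth, dif_pos hA, ← path_length_eq_dist h𝒜 hp, ← hs,
    ← path_length_eq_dist h𝒜 hp.tail, ← SimpleGraph.Walk.length_tail_add_one hnil]
  exact Nat.lt_succ_self _

/-- `A` is the first vertex after `b` on the path from `b` to the root. The rest of that path is the
path from `A`; it does not return to `b`, so the local root of `A` is another element. -/
lemma exists_mem_ne_localRoot (h𝒜 : (incidenceGraph 𝒜).IsTree) {i b : Fin n} (hb : b ≠ i) :
    ∃ A ∈ 𝒜, b ∈ A ∧ b ≠ localRoot 𝒜 i A ∧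
      setDepth 𝒜 i A < (incidenceGraph 𝒜).dist (Sum.inr b) (Sum.inr i) := by
  obtain ⟨q, hq, -⟩ := h𝒜.connected.exists_path_of_dist (Sum.inr b) (Sum.inr i)
  have hne : (Sum.inr b : {A : Finset (Fin n) // A ∈ 𝒜} ⊕ Fin n) ≠ Sum.inr i := by simpa using hb
  cases q with
  | nil => exact (hne rfl).elim
  | @cons _ v _ hadj q =>
    rcases v with ⟨A, hA⟩ | j
    · have hq' := (SimpleGraph.Walk.cons_isPath_iff _ _).1 hq
      refine ⟨A, hA, hadj, ?_, ?_⟩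
      · obtain ⟨_, p, hp, hs⟩ := isLocalRoot_localRoot h𝒜.connected i hA
        have : p = q := 
          congrArg Subtype.val ((h𝒜.isAcyclic.subsingleton_path _ _).elim ⟨p, hp⟩ ⟨q, hq'.1⟩)
        intro h
        rw [← h, this] at hs
        exact hq'.2 (hs ▸ q.getVert_mem_support 1)
      · rw [setDepth, dif_pos hA, ← path_length_eq_dist h𝒜 hq'.1, ← path_length_eq_dist h𝒜 hq,
          SimpleGraph.Walk.length_cons]
        exact Nat.lt_succ_self _
    · exact (not_adj_inr_inr _ _ hadj).elim

-- Summing degrees over one side of the bipartition counts each edge once, and the degree of `A` is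
-- its cardinality.
open Classical in
lemma card_edgeFinset_incidenceGraph (𝒜 : Finset (Finset (Fin n))) :
    (incidenceGraph 𝒜).edgeFinset.card = ∑ A ∈ 𝒜, A.card := by
  have hb : (incidenceGraph 𝒜).IsBipartiteWith
      ((Finset.univ.map Function.Embedding.inl :
        Finset ({A : Finset (Fin n) // A ∈ 𝒜} ⊕ Fin n)) : Set _)
      ((Finset.univ.map Function.Embedding.inr :
        Finset ({A : Finset (Fin n) // A ∈ 𝒜} ⊕ Fin n)) : Set _) := by
    constructor
    · rw [Set.disjoint_left]; rintro (a | a) <;> simp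
    · rintro (a | a) (b | b) h
      · exact (not_adj_inl_inl _ _ h).elim
      · simp
      · simp
      · exact (not_adj_inr_inr _ _ h).elim
  rw [← SimpleGraph.isBipartiteWith_sum_degrees_eq_card_edges hb, Finset.sum_map,
    ← Finset.sum_coe_sort 𝒜]
  refine Finset.sum_congr rfl fun A _ => ?_
  rw [← SimpleGraph.card_neighborFinset_eq_degree,
    ← Finset.card_map (Function.Embedding.inr : Fin n ↪ {A : Finset (Fin n) // A ∈ 𝒜} ⊕ Fin n)]
  congr 1
  ext v
  rw [SimpleGraph.mem_neighborFinset]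
  rcases v with B | j
  · simpa using not_adj_inl_inl A B
  · simp only [Finset.mem_map, Function.Embedding.inr_apply, Sum.inr.injEq, exists_eq_right]
    rfl

lemma isTree_iff_sum_card : (incidenceGraph 𝒜).IsTree ↔
    (incidenceGraph 𝒜).Connected ∧ ∑ A ∈ 𝒜, A.card + 1 = 𝒜.card + n := by
  classical
  rw [SimpleGraph.isTree_iff_connected_and_card, Nat.card_eq_fintype_card,
    ← SimpleGraph.edgeFinset_card, card_edgeFinset_incidenceGraph]
  simp

end Tree

end HyperpfaffianCactus

namespace HyperpfaffianCactus

/-! ### The center, a commutative ring in which unordered products make sense -/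

section Center

variable {R M : Type*} [CommRing R] [AddCommGroup M] [Module R M]

open Classical in
/-- A central element of the exterior algebra, as an element of its center. -/
noncomputable def toCenter (x : ExteriorAlgebra R M) :
    Subalgebra.center R (ExteriorAlgebra R M) :=
  if h : x ∈ Subalgebra.center R (ExteriorAlgebra R M) then ⟨x, h⟩ else 0

lemma coe_toCenter {x : ExteriorAlgebra R M}
    (h : x ∈ Subalgebra.center R (ExteriorAlgebra R M)) :
    (toCenter x : ExteriorAlgebra R M) = x := by
  rw [toCenter, dif_pos h]

lemma mul_mem_exteriorPower {p q : ℕ} {a b : ExteriorAlgebra R M} (ha : a ∈ ⋀[R]^p M)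
    (hb : b ∈ ⋀[R]^q M) : a * b ∈ ⋀[R]^(p + q) M := by
  have h : ⋀[R]^(p + q) M = ⋀[R]^p M * ⋀[R]^q M := pow_add _ _ _
  rw [h]
  exact Submodule.mul_mem_mul ha hb

lemma contractLeft_prod_eq_zero {ι : Type*} {d : Module.Dual R M} {s : Finset ι}
    {f : ι → Subalgebra.center R (ExteriorAlgebra R M)} {c : ι → R} {l : ι → List M}
    (hf : ∀ a ∈ s, (f a : ExteriorAlgebra R M) = c a • vecProd R (l a))
    (hd : ∀ a ∈ s, ∀ v ∈ l a, d v = 0) :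
    CliffordAlgebra.contractLeft d
      (((∏ a ∈ s, f a : Subalgebra.center R _) : ExteriorAlgebra R M)) = 0 := by
  classical
  induction s using Finset.induction_on with
  | empty => exact CliffordAlgebra.contractLeft_one (0 : QuadraticForm R M) (d := d)
  | insert a s ha ih =>
    rw [Finset.prod_insert ha, MulMemClass.coe_mul, hf a (Finset.mem_insert_self _ _),
      smul_mul_assoc, map_smul, contractLeft_mul_eq_zero (hd a (Finset.mem_insert_self _ _)),
      smul_zero]
    exact ih (fun b hb => hf b (Finset.mem_insert_of_mem hb))
      fun b hb => hd b (Finset.mem_insert_of_mem hb)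

lemma prod_mem_exteriorPower {ι : Type*} {s : Finset ι}
    {f : ι → Subalgebra.center R (ExteriorAlgebra R M)} {p : ι → ℕ}
    (hf : ∀ a ∈ s, (f a : ExteriorAlgebra R M) ∈ ⋀[R]^(p a) M) :
    ((∏ a ∈ s, f a : Subalgebra.center R _) : ExteriorAlgebra R M) ∈ ⋀[R]^(∑ a ∈ s, p a) M := by
  classical
  induction s using Finset.induction_on with
  | empty => exact exteriorPower_zero_eq (R := R) (M := M) ▸ Submodule.one_le.1 le_rfl
  | insert a s ha ih =>
    rw [Finset.prod_insert ha, Finset.sum_insert ha, MulMemClass.coe_mul]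
    exact mul_mem_exteriorPower (hf a (Finset.mem_insert_self _ _))
      (ih fun b hb => hf b (Finset.mem_insert_of_mem hb))

end Center

/-! ### Exponentials of sums of square-zero elements -/

section Exponential

lemma exp_sum_eq_prod_one_add {Z ι : Type*} [CommRing Z] [Module ℚ Z] {s : Finset ι} {x : ι → Z}
    (hx : ∀ a ∈ s, x a ^ 2 = 0) :
    IsNilpotent.exp (∑ a ∈ s, x a) = ∏ a ∈ s, (1 + x a) := by
  classical
  induction s using Finset.induction_on with
  | empty => simp
  | insert a s ha ih =>
    rw [Finset.sum_insert ha, Finset.prod_insert ha, IsNilpotent.exp_add_of_commute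
      (Commute.all _ _) ⟨2, hx a (Finset.mem_insert_self _ _)⟩
      (isNilpotent_sum fun b hb => ⟨2, hx b (Finset.mem_insert_of_mem hb)⟩),
      ih fun b hb => hx b (Finset.mem_insert_of_mem hb),
      IsNilpotent.exp_eq_sum (hx a (Finset.mem_insert_self _ _))]
    simp [Finset.sum_range_succ]

end Exponential

/-! ### Amplitudes as integrals: expansion, root independence, vanishing off trees -/

section Amplitude

variable {R : Type*} [CommRing R] {n : ℕ}

/-- The differences `χ_b - χ_a` as vectors, for `b` in a list. -/
def differences (R : Type*) [CommRing R] {n : ℕ} (a : Fin n) (l : List (Fin n)) :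
    List (Fin n → R) :=
  (l.map fun b => (Pi.single b 1 : Fin n → R)).map (· - Pi.single a 1)

@[simp] lemma length_differences (a : Fin n) (l : List (Fin n)) :
    (differences R a l).length = l.length := by simp [differences]

lemma totalD_chiProd_cons (a : Fin n) (l : List (Fin n)) :
    totalD (chiProd R (a :: l)) = vecProd R (differences R a l) := by
  rw [chiProd_eq_vecProd, List.map_cons, totalD,
    contractLeft_vecProd_cons (sumForm_single a), differences]
  intro w hw
  obtain ⟨b, _, rfl⟩ := List.mem_map.1 hw
  exact sumForm_single b

/-- The base point `a` and the list `l` are the head and the tail of the sorted list of `A`.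
Centrality, degree, nilpotency and the kernel property of a set term are read off this form. -/
lemma exists_setTerm_eq (y : (k : ℕ) → (Fin k → Fin n) → R) {A : Finset (Fin n)}
    (hA : A.Nonempty) : ∃ a ∈ A, ∃ l : List (Fin n), l.length + 1 = A.card ∧ (∀ b ∈ l, b ∈ A) ∧
      setTerm y A = entry y A.sort • vecProd R (differences R a l) := by
  rcases h : A.sort with - | ⟨a, l⟩
  · have := A.length_sort (· ≤ ·)
    rw [h] at this
    exact absurd this.symm hA.card_pos.ne'
  · have hm : ∀ b, b ∈ A ↔ b ∈ a :: l := fun b => by rw [← h, Finset.mem_sort]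
    refine ⟨a, (hm a).2 List.mem_cons_self, l, ?_, fun b hb => (hm b).2 (List.mem_cons_of_mem _ hb),
      ?_⟩
    · rw [← A.length_sort (· ≤ ·), h, List.length_cons]
    · rw [setTerm, h, totalD_chiProd_cons]

lemma setTerm_mem_center (y : (k : ℕ) → (Fin k → Fin n) → R) {A : Finset (Fin n)}
    (hA : Odd A.card) :
    setTerm y A ∈ Subalgebra.center R (ExteriorAlgebra R (Fin n → R)) := by
  obtain ⟨a, _, l, hl, _, h⟩ := exists_setTerm_eq y (Finset.card_pos.1 hA.pos)
  rw [h]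
  refine Subalgebra.smul_mem _ (vecProd_mem_center ?_) _
  rw [length_differences]
  rw [← hl, Nat.odd_add_one, Nat.not_odd_iff_even] at hA
  exact hA

lemma setTerm_mem_exteriorPower (y : (k : ℕ) → (Fin k → Fin n) → R) {A : Finset (Fin n)}
    (hA : A.Nonempty) : setTerm y A ∈ ⋀[R]^(A.card - 1) (Fin n → R) := by
  obtain ⟨a, _, l, hl, _, h⟩ := exists_setTerm_eq y hA
  rw [h, ← hl, Nat.add_sub_cancel]
  refine Submodule.smul_mem _ _ ?_
  simpa using vecProd_mem_exteriorPower (R := R) (differences R a l)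

lemma setTerm_sq (y : (k : ℕ) → (Fin k → Fin n) → R) {A : Finset (Fin n)} (hA : 3 ≤ A.card) :
    setTerm y A ^ 2 = 0 := by
  obtain ⟨a, _, l, hl, _, h⟩ := exists_setTerm_eq y (Finset.card_pos.1 (lt_of_lt_of_le three_pos hA))
  have h0 : vecProd R (differences R a l ++ differences R a l) = 0 := by
    refine vecProd_eq_zero_of_not_nodup fun h' => ?_
    have := List.disjoint_of_nodup_append h'
    -- A list followed by itself has no repetition only if it is empty, which the bound on the
    -- cardinality excludes.
    rcases hd : differences R a l with - | ⟨v, l'⟩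
    · have := congrArg List.length hd
      simp at this; subst this; simp at hl; omega
    · rw [hd] at this
      exact this List.mem_cons_self List.mem_cons_self
  rw [h, pow_two, smul_mul_smul_comm, ← vecProd_append, h0, smul_zero]

/-- The product of the contributions of the elements of `𝒜`, in the center of the Grassmann
algebra. -/
noncomputable def cactusProd (y : (k : ℕ) → (Fin k → Fin n) → R) (𝒜 : Finset (Finset (Fin n))) :
    Subalgebra.center R (ExteriorAlgebra R (Fin n → R)) :=
  ∏ A ∈ 𝒜, toCenter (setTerm y A)

/-- The amplitude of a set of subsets of `[n]`, as a Berezin integral. -/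
noncomputable def amplitude (y : (k : ℕ) → (Fin k → Fin n) → R) (i : Fin n)
    (𝒜 : Finset (Finset (Fin n))) : R :=
  berezin (chi R i * (cactusProd y 𝒜 : ExteriorAlgebra R (Fin n → R)))

section Exp

variable {y : (k : ℕ) → (Fin k → Fin n) → R} {F : Finset (Finset (Fin n))}

lemma sum_setTerm_eq_coe (hF : ∀ A ∈ F, Odd A.card ∧ 3 ≤ A.card) :
    ∑ A ∈ F, setTerm y A =
      ((∑ A ∈ F, toCenter (setTerm y A) : Subalgebra.center R (ExteriorAlgebra R (Fin n → R))) :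
        ExteriorAlgebra R (Fin n → R)) := by
  rw [AddSubmonoidClass.coe_finsetSum]
  exact Finset.sum_congr rfl fun A hA => (coe_toCenter (setTerm_mem_center y (hF A hA).1)).symm

lemma toCenter_setTerm_sq (hF : ∀ A ∈ F, Odd A.card ∧ 3 ≤ A.card) :
    ∀ A ∈ F, toCenter (setTerm y A) ^ 2 = 0 := fun A hA => Subtype.ext <| by
  rw [SubmonoidClass.coe_pow, coe_toCenter (setTerm_mem_center y (hF A hA).1),
    setTerm_sq y (hF A hA).2]
  rfl

lemma isNilpotent_sum_toCenter (hF : ∀ A ∈ F, Odd A.card ∧ 3 ≤ A.card) :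
    IsNilpotent (∑ A ∈ F, toCenter (setTerm y A)) :=
  isNilpotent_sum fun A hA => ⟨2, toCenter_setTerm_sq hF A hA⟩

lemma isNilpotent_sum_setTerm (hF : ∀ A ∈ F, Odd A.card ∧ 3 ≤ A.card) :
    IsNilpotent (∑ A ∈ F, setTerm y A) := by
  rw [sum_setTerm_eq_coe hF]
  exact (isNilpotent_sum_toCenter hF).map
    (Subalgebra.center R (ExteriorAlgebra R (Fin n → R))).val

/-- In the center the exponential is ∏ (1 + x_A), whose expansion runs over the subfamilies of `F`;
the inclusion of the center carries this to the whole algebra. -/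
lemma berezin_chi_mul_exp [Algebra ℚ R] (hF : ∀ A ∈ F, Odd A.card ∧ 3 ≤ A.card) (i : Fin n) :
    berezin (chi R i * IsNilpotent.exp (∑ A ∈ F, setTerm y A)) =
      ∑ 𝒜 ∈ F.powerset, amplitude y i 𝒜 := by
  have h := IsNilpotent.map_exp (isNilpotent_sum_toCenter (y := y) hF)
    (Subalgebra.center R (ExteriorAlgebra R (Fin n → R))).val
  have h' := exp_sum_eq_prod_one_add (toCenter_setTerm_sq (y := y) hF)
  rw [sum_setTerm_eq_coe hF]
  refine (congrArg (fun x => berezin (chi R i * x))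
    ((congrArg (Subalgebra.center R (ExteriorAlgebra R (Fin n → R))).val h').symm.trans h).symm).trans
      ?_
  rw [Finset.prod_one_add, Subalgebra.coe_val, AddSubmonoidClass.coe_finsetSum, Finset.mul_sum,
    ← berezinLin_apply, map_sum]
  rfl

end Exp

variable {y : (k : ℕ) → (Fin k → Fin n) → R} {𝒜 : Finset (Finset (Fin n))}

lemma cactusProd_mem_exteriorPower (h𝒜 : ∀ A ∈ 𝒜, Odd A.card ∧ 3 ≤ A.card) :
    (cactusProd y 𝒜 : ExteriorAlgebra R (Fin n → R)) ∈
      ⋀[R]^(∑ A ∈ 𝒜, (A.card - 1)) (Fin n → R) := by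
  refine prod_mem_exteriorPower fun A hA => ?_
  rw [coe_toCenter (setTerm_mem_center y (h𝒜 A hA).1)]
  exact setTerm_mem_exteriorPower y (Finset.card_pos.1 (h𝒜 A hA).1.pos)

/-- A form that is constant on each `A` vanishes on all the differences χ_b - χ_a of which the
product is made. -/
lemma contractLeft_cactusProd (h𝒜 : ∀ A ∈ 𝒜, Odd A.card ∧ 3 ≤ A.card)
    {d : Module.Dual R (Fin n → R)}
    (hd : ∀ A ∈ 𝒜, ∀ a ∈ A, ∀ b ∈ A, d (Pi.single a 1) = d (Pi.single b 1)) :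
    CliffordAlgebra.contractLeft d (cactusProd y 𝒜 : ExteriorAlgebra R (Fin n → R)) = 0 := by
  have h : ∀ A ∈ 𝒜, ∃ l : List (Fin n → R), (∀ v ∈ l, d v = 0) ∧
      (toCenter (setTerm y A) : ExteriorAlgebra R (Fin n → R)) =
        entry y A.sort • vecProd R l := by
    intro A hA
    obtain ⟨a, ha, l, _, hl, h⟩ := exists_setTerm_eq y (Finset.card_pos.1 (h𝒜 A hA).1.pos)
    refine ⟨differences R a l, ?_, by rw [coe_toCenter (setTerm_mem_center y (h𝒜 A hA).1), h]⟩
    intro v hv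
    simp only [differences, List.map_map, List.mem_map, Function.comp_apply] at hv
    obtain ⟨b, hb, rfl⟩ := hv
    rw [map_sub, hd A hA b (hl b hb) a ha, sub_self]
  choose! l hl1 hl2 using h
  exact contractLeft_prod_eq_zero hl2 hl1

/-- With P the product of the set terms, ∂P = 0, hence ∂(χ_i P) = P for every i. The difference of
two such integrands is killed by ∂ and so has integral zero. -/
lemma amplitude_eq_amplitude (h𝒜 : ∀ A ∈ 𝒜, Odd A.card ∧ 3 ≤ A.card) (i j : Fin n) :
    amplitude y i 𝒜 = amplitude y j 𝒜 := by
  have h0 : totalD (cactusProd y 𝒜 : ExteriorAlgebra R (Fin n → R)) = 0 :=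
    contractLeft_cactusProd h𝒜 fun A _ a _ b _ => by rw [sumForm_single, sumForm_single]
  have h1 : totalD (chi R i * (cactusProd y 𝒜 : ExteriorAlgebra R (Fin n → R)) -
      chi R j * (cactusProd y 𝒜 : ExteriorAlgebra R (Fin n → R))) = 0 := by
    rw [map_sub, totalD_chi_mul, totalD_chi_mul, h0, mul_zero, mul_zero, sub_self]
  have h2 := berezin_eq_zero_of_contractLeft_eq_zero (sumForm_single i) h1
  rw [← berezinLin_apply, map_sub, sub_eq_zero] at h2
  exact h2

lemma amplitude_eq_zero_of_not_isTree (h𝒜 : ∀ A ∈ 𝒜, Odd A.card ∧ 3 ≤ A.card) (i : Fin n)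
    (ht : ¬ (incidenceGraph 𝒜).IsTree) : amplitude y i 𝒜 = 0 := by
  classical
  by_cases hc : (incidenceGraph 𝒜).Connected
  · refine berezin_of_mem_exteriorPower (p := 1 + ∑ A ∈ 𝒜, (A.card - 1)) ?_
      (mul_mem_exteriorPower (by simpa using chiProd_mem_exteriorPower (R := R) [i])
        (cactusProd_mem_exteriorPower h𝒜))
    -- Degree n would be exactly the edge count that makes a connected graph a tree.
    intro h
    refine ht (isTree_iff_sum_card.2 ⟨hc, ?_⟩)
    have h2 : ∑ A ∈ 𝒜, A.card = ∑ A ∈ 𝒜, (A.card - 1) + 𝒜.card := by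
      rw [Finset.card_eq_sum_ones, ← Finset.sum_add_distrib]
      exact Finset.sum_congr rfl fun A hA => by have := (h𝒜 A hA).2; omega
    omega
  · obtain ⟨j, hj⟩ : ∃ j, ¬ (incidenceGraph 𝒜).Reachable (Sum.inr i) (Sum.inr j) := by
      by_contra! hall
      refine hc ((SimpleGraph.connected_iff_exists_forall_reachable _).2 ⟨Sum.inr i, ?_⟩)
      rintro (⟨A, hA⟩ | j)
      · obtain ⟨a, ha⟩ := Finset.card_pos.1 (h𝒜 A hA).1.pos
        have : (incidenceGraph 𝒜).Adj (Sum.inr a) (Sum.inl ⟨A, hA⟩) := ha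
        exact (hall a).trans this.reachable
      · exact hall j
    -- This form is 0 on the component of `i` and 1 elsewhere. It is constant on each set of `𝒜`, so
    -- it kills the integrand, while it takes the value 1 at `j`.
    let d : Module.Dual R (Fin n → R) :=
      ∑ a, (if (incidenceGraph 𝒜).Reachable (Sum.inr i) (Sum.inr a) then (0 : R) else 1) •
        LinearMap.proj a
    have hd : ∀ a, d (Pi.single a 1) =
        if (incidenceGraph 𝒜).Reachable (Sum.inr i) (Sum.inr a) then (0 : R) else 1 := by
      intro a
      simp only [d, LinearMap.sum_apply, LinearMap.smul_apply, LinearMap.proj_apply,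
        Pi.single_apply, smul_eq_mul, mul_ite, mul_one, mul_zero, Finset.sum_ite_eq',
        Finset.mem_univ, if_true]
    have hdj : d (Pi.single j 1) = 1 := by rw [hd, if_neg hj]
    refine berezin_eq_zero_of_contractLeft_eq_zero hdj ?_
    refine (CliffordAlgebra.contractLeft_ι_mul d _ _).trans ?_
    rw [hd, if_pos (SimpleGraph.Reachable.refl _), zero_smul, contractLeft_cactusProd h𝒜,
      mul_zero, sub_zero]
    intro A hA a ha b hb
    have h1 : (incidenceGraph 𝒜).Adj (Sum.inr a) (Sum.inl ⟨A, hA⟩) := ha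
    have h2 : (incidenceGraph 𝒜).Adj (Sum.inl ⟨A, hA⟩) (Sum.inr b) := hb
    have h3 := h1.reachable.trans h2.reachable
    rw [hd, hd]
    congr 1
    exact propext ⟨fun h => h.trans h3, fun h => h.trans h3.symm⟩

end Amplitude

end HyperpfaffianCactus

namespace HyperpfaffianCactus

/-! ### Refined cacti and the permutation π -/

section RefinedCactus

variable {n : ℕ} {𝒞 : Finset (List (Fin n))}

lemma exists_perm_ofFn_eq {l : List (Fin n)} (hl : l.length = n) (h : ∀ b, b ∈ l) :
    ∃ σ : Equiv.Perm (Fin n), List.ofFn σ = l := by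
  have hs : Function.Surjective (fun j : Fin n => l.get (Fin.cast hl.symm j)) := by
    intro b
    obtain ⟨j, hj⟩ := List.mem_iff_get.1 (h b)
    exact ⟨Fin.cast hl j, hj⟩
  refine ⟨Equiv.ofBijective _ ⟨Finite.injective_iff_surjective.2 hs, hs⟩, ?_⟩
  refine List.ext_getElem (by simp [hl]) fun m h1 h2 => ?_
  simp

lemma rotate_idxOf_eq_cons {l : List (Fin n)} {a : Fin n} (ha : a ∈ l) :
    l.rotate (l.idxOf a) = a :: (l.rotate (l.idxOf a)).tail := by
  have h := List.idxOf_lt_length_iff.2 ha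
  rw [List.rotate_eq_drop_append_take h.le, List.drop_eq_getElem_cons h, List.getElem_idxOf h,
    List.cons_append, List.tail_cons]

lemma IsRefinedCactus.mem_underlying {α : List (Fin n)} (hα : α ∈ 𝒞) :
    α.toFinset ∈ underlying 𝒞 := Finset.mem_image_of_mem _ hα

lemma IsRefinedCactus.injOn (h : IsRefinedCactus 𝒞) :
    Set.InjOn List.toFinset (𝒞 : Set (List (Fin n))) := fun α hα β hβ hαβ =>
  by_contra fun hne => h.2.1 α hα β hβ hne hαβ

lemma IsRefinedCactus.localRoot_mem (h : IsRefinedCactus 𝒞) (i : Fin n) {α : List (Fin n)}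
    (hα : α ∈ 𝒞) : localRoot (underlying 𝒞) i α.toFinset ∈ α :=
  List.mem_toFinset.1
    (HyperpfaffianCactus.localRoot_mem h.2.2.2.connected i (mem_underlying hα))

lemma IsRefinedCactus.rotate_eq (h : IsRefinedCactus 𝒞) (i : Fin n) {α : List (Fin n)}
    (hα : α ∈ 𝒞) : α.rotate (α.idxOf (localRoot (underlying 𝒞) i α.toFinset)) =
      localRoot (underlying 𝒞) i α.toFinset :: circulation 𝒞 i α :=
  rotate_idxOf_eq_cons (h.localRoot_mem i hα)

lemma IsRefinedCactus.length_circulation (h : IsRefinedCactus 𝒞) (i : Fin n)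
    {α : List (Fin n)} (hα : α ∈ 𝒞) : (circulation 𝒞 i α).length + 1 = α.length := by
  have := congrArg List.length (h.rotate_eq i hα)
  simpa using this.symm

lemma IsRefinedCactus.even_length_circulation (h : IsRefinedCactus 𝒞) (i : Fin n)
    {α : List (Fin n)} (hα : α ∈ 𝒞) : Even (circulation 𝒞 i α).length := by
  have h1 := (h.1 α hα).2.1
  rwa [← h.length_circulation i hα, Nat.odd_add_one, Nat.not_odd_iff_even] at h1

lemma IsRefinedCactus.mem_circulation (h : IsRefinedCactus 𝒞) (i : Fin n) {α : List (Fin n)}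
    (hα : α ∈ 𝒞) {b : Fin n} (hb : b ∈ α)
    (hne : b ≠ localRoot (underlying 𝒞) i α.toFinset) : b ∈ circulation 𝒞 i α := by
  rw [← List.mem_rotate (n := α.idxOf (localRoot (underlying 𝒞) i α.toFinset)),
    h.rotate_eq i hα] at hb
  exact (List.mem_cons.1 hb).resolve_left hne

lemma IsRefinedCactus.exists_mem_circulation (h : IsRefinedCactus 𝒞) {i b : Fin n}
    (hb : b ≠ i) : ∃ α ∈ 𝒞, b ∈ circulation 𝒞 i α ∧
      setDepth (underlying 𝒞) i α.toFinset <
        (incidenceGraph (underlying 𝒞)).dist (Sum.inr b) (Sum.inr i) := by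
  obtain ⟨A, hA, hbA, hne, hd⟩ := exists_mem_ne_localRoot h.2.2.2 hb
  obtain ⟨α, hα, rfl⟩ := Finset.mem_image.1 hA
  exact ⟨α, hα, h.mem_circulation i hα (List.mem_toFinset.1 hbA) hne, hd⟩

/-- The edge count of the tree gives the sequence length n, and every element occurs in it; a
surjection between sets of equal finite size is bijective, so disjointness of the circulations needs
no separate argument. -/
lemma IsRefinedCactus.exists_perm (h : IsRefinedCactus 𝒞) (i : Fin n)
    {L : List (List (Fin n))} (hL : L.Nodup) (hLC : L.toFinset = 𝒞) :
    ∃ σ : Equiv.Perm (Fin n), List.ofFn σ = i :: L.flatMap (circulation 𝒞 i) := by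
  refine exists_perm_ofFn_eq ?_ fun b => ?_
  · have h1 := (isTree_iff_sum_card.1 h.2.2.2).2
    rw [underlying, Finset.card_image_of_injOn h.injOn, Finset.sum_image h.injOn] at h1
    have h2 : ∑ α ∈ 𝒞, α.toFinset.card = ∑ α ∈ 𝒞, (circulation 𝒞 i α).length + 𝒞.card := by
      rw [Finset.card_eq_sum_ones, ← Finset.sum_add_distrib]
      refine Finset.sum_congr rfl fun α hα => ?_
      rw [h.length_circulation i hα, List.toFinset_card_of_nodup (h.1 α hα).1]
    have h3 : (L.flatMap (circulation 𝒞 i)).length = ∑ α ∈ 𝒞, (circulation 𝒞 i α).length := by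
      rw [List.length_flatMap, ← hLC, List.sum_toFinset _ hL]
    rw [List.length_cons, h3]
    omega
  · by_cases hb : b = i
    · exact hb ▸ List.mem_cons_self
    · obtain ⟨α, hα, hbα, -⟩ := h.exists_mem_circulation hb
      refine List.mem_cons_of_mem _ (List.mem_flatMap.2 ⟨α, ?_, hbα⟩)
      rwa [← hLC, List.mem_toFinset] at hα

lemma IsOddCactus.exists_isRefinedCactus {𝒜 : Finset (Finset (Fin n))} (h : IsOddCactus 𝒜) :
    ∃ 𝒞, IsRefinedCactus 𝒞 ∧ underlying 𝒞 = 𝒜 := by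
  have hu : underlying (𝒜.image fun A => A.sort) = 𝒜 := by
    rw [underlying, Finset.image_image]
    exact (Finset.image_congr fun A _ => by simp).trans Finset.image_id
  refine ⟨𝒜.image fun A => A.sort, ⟨?_, ?_, hu.symm ▸ h⟩, hu⟩
  · intro α hα
    obtain ⟨A, hA, rfl⟩ := Finset.mem_image.1 hα
    refine ⟨Finset.sort_nodup _ _, ?_⟩
    rw [Finset.length_sort]
    exact h.1 A hA
  · intro α hα β hβ hne heq
    obtain ⟨A, hA, rfl⟩ := Finset.mem_image.1 hα
    obtain ⟨B, hB, rfl⟩ := Finset.mem_image.1 hβ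
    rw [Finset.sort_toFinset, Finset.sort_toFinset] at heq
    exact hne (by rw [heq])

end RefinedCactus

/-! ### The amplitude of a cactus is a signed product of entries -/

section Amplitude

variable {R : Type*} [CommRing R] {n : ℕ} {𝒞 : Finset (List (Fin n))}

/-- The product `∏ (χ_b - χ_a)` over the circulation of `α`, where `a` is its local root. -/
noncomputable def circulationDiff (R : Type*) [CommRing R] {n : ℕ} (𝒞 : Finset (List (Fin n)))
    (i : Fin n) (α : List (Fin n)) : ExteriorAlgebra R (Fin n → R) :=
  vecProd R (differences R (localRoot (underlying 𝒞) i α.toFinset) (circulation 𝒞 i α))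

lemma IsRefinedCactus.circulationDiff_mem_center (h : IsRefinedCactus 𝒞) (i : Fin n)
    {α : List (Fin n)} (hα : α ∈ 𝒞) :
    circulationDiff R 𝒞 i α ∈ Subalgebra.center R (ExteriorAlgebra R (Fin n → R)) :=
  vecProd_mem_center (by simpa using h.even_length_circulation i hα)

lemma IsRefinedCactus.chiProd_mem_center (h : IsRefinedCactus 𝒞) (i : Fin n)
    {α : List (Fin n)} (hα : α ∈ 𝒞) :
    chiProd R (circulation 𝒞 i α) ∈ Subalgebra.center R (ExteriorAlgebra R (Fin n → R)) := by
  rw [chiProd_eq_vecProd]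
  exact vecProd_mem_center (by simpa using h.even_length_circulation i hα)

/-- Since α has odd length, rotating it to start at its local root does not change χ_α; the local
root then becomes the base point of the differences. -/
lemma IsRefinedCactus.setTerm_eq (h : IsRefinedCactus 𝒞) {y : (k : ℕ) → (Fin k → Fin n) → R}
    (hy : IsAntisymmetricFamily y) (i : Fin n) {α : List (Fin n)} (hα : α ∈ 𝒞) :
    setTerm y α.toFinset = entry y α • circulationDiff R 𝒞 i α := by
  obtain ⟨h1, h2, h3⟩ := h.1 α hα
  rw [HyperpfaffianCactus.setTerm_eq hy h1 h2 h3, circulationDiff, ← totalD_chiProd_cons,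
    ← h.rotate_eq i hα, chiProd_eq_vecProd, chiProd_eq_vecProd, List.map_rotate,
    vecProd_rotate (by simpa using h2)]

/-- Next to the product of the `χ_b` over the union of the circulations of the elements of `s`
and the root, each `χ_b - χ_a` can be replaced by `χ_b`, provided that `s` is closed under passing
to the elements closer to the root. -/
lemma IsRefinedCactus.chi_mul_prod_circulationDiff (h : IsRefinedCactus 𝒞) (i : Fin n)
    (s : Finset (List (Fin n))) (hs : s ⊆ 𝒞)
    (hclosed : ∀ α ∈ s, localRoot (underlying 𝒞) i α.toFinset = i ∨
      ∃ β ∈ s, localRoot (underlying 𝒞) i α.toFinset ∈ circulation 𝒞 i β ∧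
        setDepth (underlying 𝒞) i β.toFinset < setDepth (underlying 𝒞) i α.toFinset) :
    chi R i * ((∏ α ∈ s, toCenter (circulationDiff R 𝒞 i α) : Subalgebra.center R _) :
        ExteriorAlgebra R (Fin n → R)) =
      chi R i * ((∏ α ∈ s, toCenter (chiProd R (circulation 𝒞 i α)) : Subalgebra.center R _) :
        ExteriorAlgebra R (Fin n → R)) := by
  -- Removing a sequence of maximal depth keeps the set closed, because the witness for each
  -- remaining sequence has strictly smaller depth.
  induction s using Finset.induction_on_max_value
    (fun α => setDepth (underlying 𝒞) i (List.toFinset α)) with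
  | empty => rfl
  | insert α s hα hmax ih =>
    have hα𝒞 : α ∈ 𝒞 := hs (Finset.mem_insert_self _ _)
    have ih' := ih (fun β hβ => hs (Finset.mem_insert_of_mem hβ)) (by
      intro β hβ
      refine (hclosed β (Finset.mem_insert_of_mem hβ)).imp_right ?_
      rintro ⟨γ, hγ, h1, h2⟩
      refine ⟨γ, (Finset.mem_insert.1 hγ).resolve_left ?_, h1, h2⟩
      rintro rfl
      exact (h2.trans_le (hmax β hβ)).false)
    rw [Finset.prod_insert hα, Finset.prod_insert hα, mul_comm, mul_comm (toCenter (chiProd _ _)),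
      MulMemClass.coe_mul, MulMemClass.coe_mul, ← mul_assoc, ← mul_assoc, ih',
      coe_toCenter (h.circulationDiff_mem_center i hα𝒞),
      coe_toCenter (h.chiProd_mem_center i hα𝒞), chiProd_eq_vecProd, circulationDiff, differences]
    -- It remains to see that the product built so far is killed by χ at the local root of `α`: this
    -- generator is χ_i itself or occurs in an earlier circulation.
    refine mul_vecProd_sub ?_ _
    change _ * chi R (localRoot (underlying 𝒞) i α.toFinset) = 0
    set P : Subalgebra.center R (ExteriorAlgebra R (Fin n → R)) :=
      ∏ β ∈ s, toCenter (chiProd R (circulation 𝒞 i β)) with hP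
    have hcomm : ∀ x : ExteriorAlgebra R (Fin n → R), (P : ExteriorAlgebra R (Fin n → R)) * x =
        x * P := fun x => (Subalgebra.mem_center_iff.1 P.2 x).symm
    rcases hclosed α (Finset.mem_insert_self _ _) with hr | ⟨β, hβ, hr, hd⟩
    · rw [hr, mul_assoc, hcomm, ← mul_assoc]
      have : chi R i * chi R i = 0 := ExteriorAlgebra.ι_sq_zero _
      rw [this, zero_mul]
    · have hβs : β ∈ s := (Finset.mem_insert.1 hβ).resolve_left fun hβα => by
        subst hβα; exact hd.false
      have hz : chi R (localRoot (underlying 𝒞) i α.toFinset) *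
          (P : ExteriorAlgebra R (Fin n → R)) = 0 := by
        rw [hP, ← Finset.mul_prod_erase s _ hβs, MulMemClass.coe_mul, ← mul_assoc,
          coe_toCenter (h.chiProd_mem_center i (hs hβ)), chi_mul_chiProd_of_mem hr, zero_mul]
      rw [mul_assoc, hcomm, hz, mul_zero]

lemma coe_prod_toCenter_chiProd {ι : Type*} {L : List ι} {f : ι → List (Fin n)}
    (hf : ∀ α ∈ L, chiProd R (f α) ∈ Subalgebra.center R (ExteriorAlgebra R (Fin n → R))) :
    (((L.map fun α => toCenter (chiProd R (f α))).prod : Subalgebra.center R _) :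
      ExteriorAlgebra R (Fin n → R)) = chiProd R (L.flatMap f) := by
  induction L with
  | nil => rfl
  | cons α L ih =>
    rw [List.map_cons, List.prod_cons, MulMemClass.coe_mul,
      coe_toCenter (hf α List.mem_cons_self), ih fun β hβ => hf β (List.mem_cons_of_mem _ hβ),
      List.flatMap_cons, chiProd_append]

lemma IsRefinedCactus.isAmplitude (h : IsRefinedCactus 𝒞) {y : (k : ℕ) → (Fin k → Fin n) → R}
    (hy : IsAntisymmetricFamily y) (i : Fin n) :
    IsAmplitude y i 𝒞 (amplitude y i (underlying 𝒞)) := by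
  intro L hL hLC
  obtain ⟨σ, hσ⟩ := h.exists_perm i hL hLC
  refine ⟨σ, hσ, ?_⟩
  have h1 : cactusProd y (underlying 𝒞) =
      (∏ α ∈ 𝒞, entry y α) • ∏ α ∈ 𝒞, toCenter (circulationDiff R 𝒞 i α) := by
    rw [cactusProd, underlying, Finset.prod_image h.injOn, ← Finset.prod_smul]
    refine Finset.prod_congr rfl fun α hα => Subtype.ext ?_
    have h2 := h.setTerm_eq hy i hα
    have hc := h.circulationDiff_mem_center (R := R) i hα
    rw [coe_toCenter (h2 ▸ Subalgebra.smul_mem _ hc _), Subalgebra.coe_smul, coe_toCenter hc, h2]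
  have h2 : chi R i * ((∏ α ∈ 𝒞, toCenter (circulationDiff R 𝒞 i α) : Subalgebra.center R _) :
      ExteriorAlgebra R (Fin n → R)) = chiProd R (List.ofFn σ) := by
    rw [h.chi_mul_prod_circulationDiff i 𝒞 subset_rfl, hσ, chiProd_cons,
      ← coe_prod_toCenter_chiProd, ← hLC, List.prod_toFinset _ hL]
    · intro α hα
      exact h.chiProd_mem_center i (hLC ▸ List.mem_toFinset.2 hα)
    · intro α hα
      by_cases hr : localRoot (underlying 𝒞) i α.toFinset = i
      · exact Or.inl hr
      · obtain ⟨β, hβ, hm, hd⟩ := h.exists_mem_circulation hr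
        exact Or.inr ⟨β, hβ, hm, hd.trans (dist_localRoot_lt h.2.2.2 i (mem_underlying hα))⟩
  rw [amplitude, h1, Subalgebra.coe_smul, mul_smul_comm, h2, ← berezinLin_apply, map_smul,
    berezinLin_apply, berezin_chiProd_perm, smul_eq_mul, zsmul_eq_mul, mul_comm]

end Amplitude

end HyperpfaffianCactus

namespace HyperpfaffianCactus

/-! ### Cutting positions into blocks -/

section Blocks

variable {m N : ℕ}

/-- The positions `{0, …, N - 1}` as pairs (block, position in the block). -/
def blockEquiv (h : m ∣ N) : Fin (N / m) × Fin m ≃ Fin N :=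
  finProdFinEquiv.trans (finCongr (Nat.div_mul_cancel h))

lemma blockEquiv_apply (h : m ∣ N) (j : Fin (N / m)) (r : Fin m) :
    blockEquiv h (j, r) = blockIndex j r := by
  ext
  simp [blockEquiv, blockIndex, add_comm]

lemma flatMap_ofFn_blockIndex {X : Type*} (h : m ∣ N) (γ : Fin N → X) :
    (List.finRange (N / m)).flatMap (fun j => List.ofFn fun r => γ (blockIndex j r)) =
      List.ofFn γ := by
  have key : ∀ (p : ℕ) (hp : m * p = N), (List.finRange p).flatMap
      (fun j : Fin p => List.ofFn fun r : Fin m => γ ⟨m * j + r, by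
        have h1 : m * (j + 1) ≤ m * p := Nat.mul_le_mul_left m j.2
        have h3 := r.2
        rw [Nat.mul_add] at h1
        omega⟩) = List.ofFn γ := by
    rintro p rfl
    rw [List.ofFn_mul', List.flatMap_def, ← List.ofFn_eq_map]
  exact key (N / m) (Nat.mul_div_cancel' h)

end Blocks

/-! ### Expansion of the exponential into monomials -/

section Expansion

variable {R : Type*} [CommRing R]

/-- The sequence is a permutation composed of `σ`, shifted so as to fix 0, and of the cycle moving 0
to `i`, whose sign is (-1)^i. -/
lemma berezin_chi_mul_chiProd_succAbove {N : ℕ} (i : Fin (N + 1)) (σ : Equiv.Perm (Fin N)) :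
    berezin (chi R i * chiProd R (List.ofFn fun b => i.succAbove (σ b))) =
      (-1) ^ (i : ℕ) * ((Equiv.Perm.sign σ : ℤ) : R) := by
  have h : i :: List.ofFn (fun b => i.succAbove (σ b)) =
      List.ofFn (i.cycleRange.symm * Equiv.Perm.decomposeFin.symm (0, σ) :
        Equiv.Perm (Fin (N + 1))) := by
    rw [List.ofFn_succ]
    simp
  rw [← chiProd_cons, h, berezin_chiProd_perm, Equiv.Perm.sign_mul, Equiv.Perm.sign_symm,
    Fin.sign_cycleRange, Equiv.Perm.decomposeFin.symm_sign]
  simp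

lemma exists_perm_succAbove {N : ℕ} {i : Fin (N + 1)} {γ : Fin N → Fin (N + 1)}
    (h : (i :: List.ofFn γ).Nodup) :
    ∃ σ : Equiv.Perm (Fin N), ∀ b, i.succAbove (σ b) = γ b := by
  rw [List.nodup_cons, List.nodup_ofFn] at h
  have h1 : ∀ b, ∃ c, i.succAbove c = γ b := fun b =>
    Fin.exists_succAbove_eq fun hb => h.1 (List.mem_ofFn.2 ⟨b, hb⟩)
  choose f hf using h1
  have hinj : Function.Injective f := fun a b hab => h.2 (by rw [← hf, ← hf, hab])
  exact ⟨Equiv.ofBijective f ⟨hinj, Finite.injective_iff_surjective.1 hinj⟩, hf⟩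

variable {m N : ℕ}

lemma chiProd_ofFn_mem_center {n : ℕ} (hm : Even m) (β : Fin m → Fin n) :
    chiProd R (List.ofFn β) ∈ Subalgebra.center R (ExteriorAlgebra R (Fin n → R)) := by
  rw [chiProd_eq_vecProd]
  exact vecProd_mem_center (by simpa using hm)

lemma sum_smul_chiProd_pow {n : ℕ} (hm : Even m) (s : Finset (Fin m → Fin n))
    (A : (Fin m → Fin n) → R) (p : ℕ) :
    (∑ β ∈ s, A β • chiProd R (List.ofFn β)) ^ p =
      ∑ x ∈ Fintype.piFinset (fun _ : Fin p => s), (∏ j, A (x j)) •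
        chiProd R ((List.finRange p).flatMap fun j => List.ofFn (x j)) := by
  have h : ∑ β ∈ s, A β • chiProd R (List.ofFn β) =
      ((∑ β ∈ s, A β • toCenter (chiProd R (List.ofFn β)) : Subalgebra.center R _) :
        ExteriorAlgebra R (Fin n → R)) := by
    rw [AddSubmonoidClass.coe_finsetSum]
    refine Finset.sum_congr rfl fun β _ => ?_
    rw [Subalgebra.coe_smul, coe_toCenter (chiProd_ofFn_mem_center hm β)]
  have h2 := Finset.prod_univ_sum (fun _ : Fin p => s)
    (fun _ β => A β • (toCenter (chiProd R (List.ofFn β)) :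
      Subalgebra.center R (ExteriorAlgebra R (Fin n → R))))
  rw [Finset.prod_const, Finset.card_univ, Fintype.card_fin] at h2
  rw [h, ← SubmonoidClass.coe_pow, h2, AddSubmonoidClass.coe_finsetSum]
  refine Finset.sum_congr rfl fun x _ => ?_
  rw [Finset.prod_smul, Subalgebra.coe_smul, ← coe_prod_toCenter_chiProd
    fun j _ => chiProd_ofFn_mem_center hm (x j),
    Fin.prod_univ_def (fun j => toCenter (chiProd R (List.ofFn (x j))))]

/-- Terms of the expanded power are families of N/m blocks. A repeated index, or the index `i`,
makes the monomial vanish; the other families are the permutations of the complement of `i`. The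
predicate `P` allows both increasing blocks (hyperpfaffian) and arbitrary ones (Pfaffian). -/
lemma berezin_chi_mul_pow (hm : Even m) (h : m ∣ N) (i : Fin (N + 1))
    (P : (Fin m → Fin (N + 1)) → Prop) [DecidablePred P] (A : (Fin m → Fin (N + 1)) → R) :
    berezin (chi R i * (∑ β with P β, A β • chiProd R (List.ofFn β)) ^ (N / m)) =
      (-1) ^ (i : ℕ) * ∑ σ : Equiv.Perm (Fin N) with
        (∀ j : Fin (N / m), P fun r => i.succAbove (σ (blockIndex j r))),
        (Equiv.Perm.sign σ : ℤ) •
          ∏ j : Fin (N / m), A fun r => i.succAbove (σ (blockIndex j r)) := by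
  rw [sum_smul_chiProd_pow hm, Finset.mul_sum, ← berezinLin_apply, map_sum, Finset.mul_sum]
  symm
  refine Finset.sum_of_injOn
    (fun (σ : Equiv.Perm (Fin N)) (j : Fin (N / m)) (r : Fin m) =>
      i.succAbove (σ (blockIndex j r))) ?_ ?_ ?_ ?_
  · intro σ _ τ _ hστ
    ext b : 1
    obtain ⟨⟨j, r⟩, rfl⟩ := (blockEquiv h).surjective b
    rw [blockEquiv_apply]
    exact Fin.succAbove_right_injective (congrFun (congrFun hστ j) r)
  · intro σ hσ
    simpa [Fintype.mem_piFinset] using hσ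
  · intro x hx hx'
    set γ : Fin N → Fin (N + 1) := fun b => x ((blockEquiv h).symm b).1 ((blockEquiv h).symm b).2
      with hγ
    have hγx : ∀ j r, γ (blockIndex j r) = x j r := fun j r => by
      simp [hγ, ← blockEquiv_apply h]
    have h1 : ((List.finRange (N / m)).flatMap fun j => List.ofFn (x j)) = List.ofFn γ := by
      rw [← flatMap_ofFn_blockIndex h γ]
      simp_rw [hγx]
    rw [h1, mul_smul_comm, ← chiProd_cons]
    by_cases hnd : (i :: List.ofFn γ).Nodup
    · exfalso
      obtain ⟨σ, hσ⟩ := exists_perm_succAbove hnd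
      refine hx' ⟨σ, ?_, ?_⟩
      · simpa [Fintype.mem_piFinset, hσ, hγx] using hx
      · funext j r
        exact (hσ _).trans (hγx j r)
    · rw [chiProd_eq_zero_of_not_nodup hnd, smul_zero, map_zero]
  · intro σ _
    dsimp only
    rw [flatMap_ofFn_blockIndex h fun b => i.succAbove (σ b), mul_smul_comm _ (chi R i), map_smul,
      berezinLin_apply, berezin_chi_mul_chiProd_succAbove, smul_eq_mul, zsmul_eq_mul]
    ring

/-- The Berezin integral of an exponential of an element of even degree `m`. -/
lemma berezin_chi_mul_exp_of_degree [Algebra ℚ R] (hm : Even m) (h0 : 0 < m) (i : Fin (N + 1))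
    (P : (Fin m → Fin (N + 1)) → Prop) [DecidablePred P] (A : (Fin m → Fin (N + 1)) → R) (c : ℚ)
    {S : ExteriorAlgebra R (Fin (N + 1) → R)} (hnil : IsNilpotent S)
    (hS : S = c • ∑ β with P β, A β • chiProd R (List.ofFn β)) :
    berezin (chi R i * IsNilpotent.exp S) =
      if m ∣ N then (-1) ^ (i : ℕ) * ((((N / m).factorial : ℕ) : ℚ)⁻¹ * c ^ (N / m)) •
        ∑ σ : Equiv.Perm (Fin N) with
          (∀ j : Fin (N / m), P fun r => i.succAbove (σ (blockIndex j r))),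
          (Equiv.Perm.sign σ : ℤ) •
            ∏ j : Fin (N / m), A fun r => i.succAbove (σ (blockIndex j r))
      else 0 := by
  obtain ⟨K, hK⟩ := hnil
  -- The truncation order is enlarged so that the exponent N/m is certainly in range.
  have hK' : S ^ (K + N + 1) = 0 := pow_eq_zero_of_le (by omega) hK
  have hq : ∀ (q : ℚ) (x : ExteriorAlgebra R (Fin (N + 1) → R)),
      q • x = algebraMap ℚ R q • x := fun q x => (algebraMap_smul R q x).symm
  have hdeg : ∀ p, S ^ p ∈ ⋀[R]^(m * p) (Fin (N + 1) → R) := by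
    have h1 : S ∈ ⋀[R]^m (Fin (N + 1) → R) := by
      rw [hS, hq]
      refine Submodule.smul_mem _ _ (Submodule.sum_mem _ fun β _ => Submodule.smul_mem _ _ ?_)
      simpa using chiProd_mem_exteriorPower (R := R) (List.ofFn β)
    intro p
    induction p with
    | zero =>
      rw [pow_zero]
      exact exteriorPower_zero_eq (R := R) (M := Fin (N + 1) → R) ▸ Submodule.one_le.1 le_rfl
    | succ p ih =>
      rw [pow_succ, Nat.mul_succ]
      exact mul_mem_exteriorPower ih h1
  have hzero : ∀ p, m * p ≠ N → berezin (chi R i * S ^ p) = 0 := fun p hp => by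
    refine berezin_of_mem_exteriorPower (p := 1 + m * p) (by omega)
      (mul_mem_exteriorPower (by simpa using chiProd_mem_exteriorPower (R := R) [i]) (hdeg p))
  have hexp : berezin (chi R i * IsNilpotent.exp S) =
      ∑ p ∈ Finset.range (K + N + 1), ((p.factorial : ℕ) : ℚ)⁻¹ • berezin (chi R i * S ^ p) := by
    rw [IsNilpotent.exp_eq_sum hK', Finset.mul_sum, ← berezinLin_apply, map_sum]
    refine Finset.sum_congr rfl fun p _ => ?_
    rw [hq, mul_smul_comm, map_smul, algebraMap_smul, berezinLin_apply]
  rw [hexp]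
  split_ifs with hdvd
  · rw [Finset.sum_eq_single (N / m)]
    · rw [hS, smul_pow, hq, mul_smul_comm, ← berezinLin_apply, map_smul, berezinLin_apply,
        berezin_chi_mul_pow hm hdvd, algebraMap_smul, smul_smul, mul_smul_comm]
    · intro p _ hp
      rw [hzero p, smul_zero]
      rintro rfl
      exact hp (Nat.mul_div_cancel_left p h0).symm
    · intro hp
      have := Nat.div_le_self N m
      exact absurd (Finset.mem_range.2 (by omega)) hp
  · refine Finset.sum_eq_zero fun p _ => ?_
    rw [hzero p, smul_zero]
    rintro rfl
    exact hdvd (Dvd.intro p rfl)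

end Expansion

/-! ### Hyperpfaffians and Pfaffians as Berezin integrals -/

section Pfaffians

variable {R : Type*} [CommRing R] {N m : ℕ}

/-- The tensor `A_{α_2 … α_k} = ∑_{α_1} y^[k]_{α_1 … α_k}` with indices in `[n]`. -/
def fullContraction {n : ℕ} (y : (k : ℕ) → (Fin k → Fin n) → R) (m : ℕ) (β : Fin m → Fin n) : R :=
  ∑ a : Fin n, y (m + 1) (Fin.cons a β)

lemma skip_eq_succAbove (i : Fin (N + 1)) (a : Fin N) : skip i a = i.succAbove a := by
  ext
  simp only [skip, Fin.succAbove, Fin.lt_def, Fin.val_castSucc]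
  split_ifs <;> simp

lemma contractedTensor_eq (y : (k : ℕ) → (Fin k → Fin (N + 1)) → R) (i : Fin (N + 1)) :
    (contractedTensor y (m + 1) i : (Fin m → Fin N) → R) =
      fun β => fullContraction y m fun r => i.succAbove (β r) := by
  funext β
  refine Finset.sum_congr rfl fun a _ => ?_
  rw [← entry_ofFn y, List.ofFn_succ]
  simp only [Fin.cons_zero, Fin.cons_succ]
  congr 3
  funext r
  exact skip_eq_succAbove i (β r)

variable [Algebra ℚ R]

lemma actionTerm_eq_sum_fullContraction {n : ℕ} (y : (k : ℕ) → (Fin k → Fin n) → R) (m : ℕ) :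
    actionTerm y (m + 1) = ((m.factorial : ℕ) : ℚ)⁻¹ •
      ∑ β : Fin m → Fin n, fullContraction y m β • chiProd R (List.ofFn β) := by
  rw [actionTerm, Nat.add_sub_cancel]
  congr 1
  rw [← (Fin.consEquiv fun _ => Fin n).sum_comp, Fintype.sum_prod_type, Finset.sum_comm]
  refine Finset.sum_congr rfl fun β _ => ?_
  rw [fullContraction, Finset.sum_smul]
  refine Finset.sum_congr rfl fun a _ => ?_
  simp [Fin.consEquiv, List.ofFn_succ, chiProd]

lemma actionTerm_eq_sum_strictMono {n : ℕ} {y : (k : ℕ) → (Fin k → Fin n) → R}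
    (hy : IsAntisymmetricFamily y) (hk : Odd (m + 1)) (h3 : 3 ≤ m + 1) (hn : m + 1 ≤ n) :
    actionTerm y (m + 1) =
      ∑ β : Fin m → Fin n with StrictMono β, fullContraction y m β • chiProd R (List.ofFn β) := by
  rw [actionTerm_eq_sum_fullContraction, sum_eq_factorial_nsmul_sum_strictMono,
    ← Nat.cast_smul_eq_nsmul ℚ, smul_smul, inv_mul_cancel₀, one_smul]
  · exact_mod_cast m.factorial_ne_zero
  · intro β σ
    have h : fullContraction y m (β ∘ σ) = (Equiv.Perm.sign σ : ℤ) • fullContraction y m β := by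
      rw [fullContraction, fullContraction, Finset.smul_sum]
      refine Finset.sum_congr rfl fun a _ => ?_
      -- Extending `σ` to fix the contracted index 0 preserves its sign.
      have h1 : (Fin.cons a (β ∘ σ) : Fin (m + 1) → Fin n) =
          (Fin.cons a β : Fin (m + 1) → Fin n) ∘ Equiv.Perm.decomposeFin.symm (0, σ) := by
        funext j
        cases j using Fin.cases <;> simp
      rw [h1, hy _ hk h3 hn, Equiv.Perm.decomposeFin.symm_sign, if_pos rfl, one_mul]
    rw [h, chiProd_ofFn_comp_perm]
    rcases Int.units_eq_one_or (Equiv.Perm.sign σ) with h | h <;> simp [h]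
  · intro β hβ
    rw [chiProd_eq_zero_of_not_nodup (by rwa [List.nodup_ofFn]), smul_zero]

lemma neg_one_pow_mul_hyperpfaffian {y : (k : ℕ) → (Fin k → Fin (N + 1)) → R}
    (hy : IsAntisymmetricFamily y) (hk : Odd (m + 1)) (h3 : 3 ≤ m + 1) (hn : m + 1 ≤ N + 1)
    (hnil : IsNilpotent (actionTerm y (m + 1))) (i : Fin (N + 1)) :
    (-1) ^ (i : ℕ) * hyperpfaffian (contractedTensor y (m + 1) i) =
      berezin (chi R i * IsNilpotent.exp (actionTerm y (m + 1))) := by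
  have hm : Even m := by rwa [Nat.odd_add_one, Nat.not_odd_iff_even] at hk
  -- With increasing blocks the factor 1/m! has been absorbed, so the constant is 1.
  rw [berezin_chi_mul_exp_of_degree hm (by omega) i StrictMono (fullContraction y m) 1 hnil
    (by rw [one_smul, actionTerm_eq_sum_strictMono hy hk h3 hn])]
  change (-1) ^ (i : ℕ) * hyperpfaffian
    (contractedTensor y (m + 1) i : (Fin m → Fin N) → R) = _
  rw [contractedTensor_eq, hyperpfaffian, mul_ite, mul_zero, one_pow, mul_one]
  congr 3
  refine Finset.sum_congr ?_ fun _ _ => rfl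
  ext σ
  simp only [Finset.mem_filter, Finset.mem_univ, true_and, StrictMono,
    (Fin.strictMono_succAbove i).lt_iff_lt]
  rfl

lemma neg_one_pow_mul_pfaffian {y : (k : ℕ) → (Fin k → Fin (N + 1)) → R}
    (hnil : IsNilpotent (actionTerm y 3)) (i : Fin (N + 1)) :
    (-1) ^ (i : ℕ) * pfaffian (contractedMatrix y i) =
      berezin (chi R i * IsNilpotent.exp (actionTerm y 3)) := by
  -- Blocks are unrestricted, and the constant 1/2 = 1/2! produces the 2^p in the normalization of
  -- the Pfaffian.
  rw [berezin_chi_mul_exp_of_degree even_two two_pos i (fun _ => True) (fullContraction y 2) 2⁻¹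
    hnil (by rw [actionTerm_eq_sum_fullContraction, Finset.filter_true]; norm_num)]
  have h : ∀ a b, (contractedMatrix y i : Matrix (Fin N) (Fin N) R) a b =
      fullContraction y 2 ![i.succAbove a, i.succAbove b] := by
    intro a b
    rw [← skip_eq_succAbove, ← skip_eq_succAbove]
    rfl
  have h2 : ∀ f : Fin 2 → Fin (N + 1), ![f 0, f 1] = f := fun f => by
    ext j; fin_cases j <;> rfl
  simp only [pfaffian, even_iff_two_dvd, h, mul_ite, mul_zero, implies_true, Finset.filter_true]
  congr 2
  congr 1
  · rw [Nat.cast_mul, Nat.cast_pow, mul_inv, mul_comm, inv_pow]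
    norm_num
  · refine Finset.sum_congr rfl fun σ _ => ?_
    congr 1
    refine Finset.prod_congr rfl fun j _ => ?_
    rw [← h2 fun r => i.succAbove (σ (blockIndex j r))]

end Pfaffians

end HyperpfaffianCactus

namespace HyperpfaffianCactus

/-! ### Restriction of the sums to cacti, and the theorem -/

section CactusSums

variable {R : Type*} [CommRing R] {n : ℕ} {y : (k : ℕ) → (Fin k → Fin n) → R}

lemma mem_oddCacti {𝒜 : Finset (Finset (Fin n))} : 𝒜 ∈ oddCacti n ↔ IsOddCactus 𝒜 := by
  simp [oddCacti]

lemma sum_amplitude_powerset {F : Finset (Finset (Fin n))}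
    (hF : ∀ A ∈ F, Odd A.card ∧ 3 ≤ A.card) (i : Fin n) {T : Finset (Finset (Finset (Fin n)))}
    (hT : ∀ 𝒜, 𝒜 ∈ T ↔ 𝒜 ⊆ F ∧ IsOddCactus 𝒜) :
    ∑ 𝒜 ∈ F.powerset, amplitude y i 𝒜 = ∑ 𝒜 ∈ T, amplitude y i 𝒜 := by
  symm
  refine Finset.sum_subset (fun 𝒜 h𝒜 => Finset.mem_powerset.2 ((hT 𝒜).1 h𝒜).1) ?_
  intro 𝒜 h𝒜 hn
  have hsub := Finset.mem_powerset.1 h𝒜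
  refine amplitude_eq_zero_of_not_isTree (fun A hA => hF A (hsub hA)) i fun ht => hn ?_
  exact (hT 𝒜).2 ⟨hsub, fun A hA => hF A (hsub hA), ht⟩

variable [Algebra ℚ R]

lemma berezin_chi_mul_exp_action (hy : IsAntisymmetricFamily y) (i : Fin n) :
    berezin (chi R i * IsNilpotent.exp (action y)) = ∑ 𝒜 ∈ oddCacti n, amplitude y i 𝒜 := by
  have hF : ∀ A ∈ Finset.univ.filter fun A : Finset (Fin n) => Odd A.card ∧ 3 ≤ A.card,
      Odd A.card ∧ 3 ≤ A.card := fun A hA => (Finset.mem_filter.1 hA).2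
  rw [action_eq hy, berezin_chi_mul_exp hF, sum_amplitude_powerset hF]
  intro 𝒜
  rw [mem_oddCacti]
  exact ⟨fun h => ⟨fun A hA => by simpa using h.1 A hA, h⟩, fun h => h.2⟩

lemma berezin_chi_mul_exp_actionTerm (hy : IsAntisymmetricFamily y) {k : ℕ} (hk : Odd k)
    (h3 : 3 ≤ k) (hn : k ≤ n) (i : Fin n) :
    berezin (chi R i * IsNilpotent.exp (actionTerm y k)) =
      ∑ 𝒜 ∈ regularCacti n k, amplitude y i 𝒜 := by
  have hF : ∀ A ∈ Finset.univ.filter fun A : Finset (Fin n) => A.card = k,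
      Odd A.card ∧ 3 ≤ A.card := fun A hA => by
    rw [(Finset.mem_filter.1 hA).2]
    exact ⟨hk, h3⟩
  rw [actionTerm_eq hy hk h3 hn, berezin_chi_mul_exp hF, sum_amplitude_powerset hF]
  intro 𝒜
  rw [regularCacti, Finset.mem_filter, mem_oddCacti]
  exact ⟨fun h => ⟨fun A hA => by simpa using h.2 A hA, h.1⟩,
    fun h => ⟨h.2, fun A hA => by simpa using h.1 hA⟩⟩

lemma isNilpotent_action (hy : IsAntisymmetricFamily y) : IsNilpotent (action y) := by
  rw [action_eq hy]
  exact isNilpotent_sum_setTerm fun A hA => (Finset.mem_filter.1 hA).2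

lemma isNilpotent_actionTerm (hy : IsAntisymmetricFamily y) {k : ℕ} (hk : Odd k)
    (h3 : 3 ≤ k) (hn : k ≤ n) : IsNilpotent (actionTerm y k) := by
  rw [actionTerm_eq hy hk h3 hn]
  refine isNilpotent_sum_setTerm fun A hA => ?_
  rw [(Finset.mem_filter.1 hA).2]
  exact ⟨hk, h3⟩

end CactusSums

end HyperpfaffianCactus

theorem theorem2 {R : Type*} [CommRing R] [Algebra ℚ R] {n : ℕ} (hn : Odd n)
    (y : (k : ℕ) → (Fin k → Fin n) → R) (hy : IsAntisymmetricFamily y) :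
    -- the exponent is nilpotent, so that its exponential is a finite sum
    IsNilpotent (action y) ∧
    (∀ k, Odd k → 3 ≤ k → k ≤ n → IsNilpotent (actionTerm y k)) ∧
    -- the amplitude `Y 𝒜` of a cactus: well defined, independent of the root and the refinement
    ∃ Y : Finset (Finset (Fin n)) → R,
      (∀ 𝒜, IsOddCactus 𝒜 →
        (∃ 𝒞, IsRefinedCactus 𝒞 ∧ underlying 𝒞 = 𝒜) ∧
        ∀ 𝒞, IsRefinedCactus 𝒞 → underlying 𝒞 = 𝒜 → ∀ i : Fin n, IsAmplitude y i 𝒞 (Y 𝒜)) ∧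
      -- the Berezin integral does not depend on the root and is the sum over all odd cacti
      (∀ i : Fin n,
        berezin (chi R i * IsNilpotent.exp (action y)) = ∑ 𝒜 ∈ oddCacti n, Y 𝒜) ∧
      -- a single `k`: the hyperpfaffian-cactus identity
      (∀ k, Odd k → 3 ≤ k → k ≤ n → ∀ i : Fin n,
        berezin (chi R i * IsNilpotent.exp (actionTerm y k)) = ∑ 𝒜 ∈ regularCacti n k, Y 𝒜 ∧
        (-1) ^ (i : ℕ) * hyperpfaffian (contractedTensor y k i) =
          ∑ 𝒜 ∈ regularCacti n k, Y 𝒜) ∧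
      -- `k = 3`: the Pfaffian-tree theorem
      (3 ≤ n → ∀ i : Fin n,
        (-1) ^ (i : ℕ) * pfaffian (contractedMatrix y i) = ∑ 𝒜 ∈ regularCacti n 3, Y 𝒜) := by
  -- Oddness makes n positive, so the index 0 is available as a reference root.
  obtain ⟨N, rfl⟩ : ∃ N, n = N + 1 := ⟨n - 1, by have := hn.pos; omega⟩
  have hnil := fun k (hk : Odd k) (h3 : 3 ≤ k) (hkn : k ≤ N + 1) =>
    isNilpotent_actionTerm hy hk h3 hkn
  have hindep : ∀ i 𝒜, 𝒜 ∈ oddCacti (N + 1) → amplitude y i 𝒜 = amplitude y 0 𝒜 :=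
    fun i 𝒜 h𝒜 => amplitude_eq_amplitude (mem_oddCacti.1 h𝒜).1 i 0
  have hreg : ∀ k, Odd k → 3 ≤ k → k ≤ N + 1 → ∀ i : Fin (N + 1),
      berezin (chi R i * IsNilpotent.exp (actionTerm y k)) =
        ∑ 𝒜 ∈ regularCacti (N + 1) k, amplitude y 0 𝒜 := fun k hk h3 hkn i => by
    rw [berezin_chi_mul_exp_actionTerm hy hk h3 hkn]
    exact Finset.sum_congr rfl fun 𝒜 h𝒜 => hindep i 𝒜 (Finset.mem_filter.1 h𝒜).1
  -- The amplitude at root 0 serves as `Y`; root independence transfers every statement at `i` to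
  -- it.
  refine ⟨isNilpotent_action hy, hnil, amplitude y 0, ?_, ?_, ?_, ?_⟩
  · intro 𝒜 h𝒜
    refine ⟨h𝒜.exists_isRefinedCactus, ?_⟩
    rintro 𝒞 h𝒞 rfl i
    rw [amplitude_eq_amplitude h𝒜.1 0 i]
    exact h𝒞.isAmplitude hy i
  · intro i
    rw [berezin_chi_mul_exp_action hy]
    exact Finset.sum_congr rfl fun 𝒜 h𝒜 => hindep i 𝒜 h𝒜
  · intro k hk h3 hkn i
    refine ⟨hreg k hk h3 hkn i, ?_⟩
    rw [← hreg k hk h3 hkn i]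
    obtain ⟨m, rfl⟩ : ∃ m, k = m + 1 := ⟨k - 1, by omega⟩
    exact neg_one_pow_mul_hyperpfaffian hy hk h3 hkn (hnil _ hk h3 hkn) i
  · intro h3 i
    have hodd : Odd 3 := by decide
    rw [← hreg 3 hodd le_rfl h3 i]
    exact neg_one_pow_mul_pfaffian (hnil 3 hodd le_rfl h3) i
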